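/- Let $\mathcal G=\mathrm{SO}(2)_L\ltimes\mathbb R^3\times\mathrm{SO}(2)_R$, with multiplication $(\phi_1,a_1,\theta_1)(\phi_2,a_2,\theta_2)=(\phi_1+\phi_2,\;a_1+R_{\phi_1}a_2,\;\theta_1+\theta_2)$, where $R_\phi$ is the rotation of $\mathbb R^3$ by $\phi$ about $\mathbf e_3$. Let $\mathcal G$ act smoothly, properly, faithfully and symplectically on a connected 12-dimensional symplectic manifold $(\mathcal M,\Omega)$. Let $H:\mathcal M\to\mathbb R$ be a smooth $\mathcal G$-invariant Hamiltonian with Hamiltonian vector field $f_H$, $\Omega(f_H,\cdot)=\mathrm dH$, and let $J=(J^\phi,J^a,J^\theta):\mathcal M\to\mathfrak g^*$ be a coadjoint-equivariant momentum map, $\Omega(\xi x,\cdot)=\mathrm dJ_\xi(x)$ for $\xi\in\mathfrak g$, $x\in\mathcal M$. Let $x_e$ be an axisymmetric relative equilibrium: $f_H(x_e)=\xi_e x_e$ for some $\xi_e\in\mathfrak g$, and the isotropy group of $x_e$ is the diagonal $\mathrm{SO}(2)_D=\{(\phi,0,\phi)\}$. Let $\mathcal K=\mathbb R^3\times\mathrm{SO}(2)_R=\{(0,a,\theta)\}$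 and let $w\in W=\mathbb R^4$ (with the standard symplectic structure, structure matrix $\mathbb J$) be canonical coordinates near $[x_e]$, with $w=0$ at $[x_e]$, on the symplectic reduced space of $\mathcal K$ at the momentum $\nu_e=(J^a,J^\theta)(x_e)$. In these coordinates the reduced system is $\dot w=\mathbb J\,\mathrm D_wH(w)$, with equilibrium $w=0$, and $J_W$ denotes the momentum $J^\phi+J^\theta$ of $\mathrm{SO}(2)_D$ restricted to the coordinate slice. The notions below do not depend on the choice of coordinates. The relative equilibrium $x_e$ is *elliptic* if all eigenvalues of $A=\mathbb J\,\mathrm D^2_wH(0)$ are nonzero and purely imaginary, *semisimple* if $A$ is semisimple, and *formally stable* if $\mathrm D_w^2(H+\lambda J_W)(0)$ is (positive or negative) definite for some $\lambda\in\mathbb R$. Numbers $\omega_1,\omega_2\in\mathbb R$ are called (signed) *normal frequencies* of $x_e$, with $\mathrm{SO}(2)_D$ acting with *types* $n_1,n_2\in\mathbb Z$ on the corresponding real $\pm i\omega_j$ eigenspaces, if $W$ is the symplectically orthogonal direct sum of two planes $W_1,W_2$, both invariant under $A$ and under the linearized $\mathrm{SO}(2)_D$-action, such that for each $j$: in some symplectic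 basis of $W_j$ the map $A|_{W_j}$ is the Hamiltonian vector field of $\frac12\omega_j(q^2+p^2)$ (so the sign of $\omega_j$ is the Krein sign), and in some symplectic basis of $W_j$ the linearized action is $z\mapsto e^{in_j\phi}z$ with momentum map $\frac12n_j|z|^2$. **Proposition.** Assume that $x_e$ is semisimple and elliptic. Then such $\omega_1,\omega_2$ and $n_1,n_2$ exist, and for every choice of them: 1. if the two normal frequencies have opposite signs, $\omega_1\omega_2<0$, then $x_e$ is formally stable if and only if there is no $n_1:n_2$ resonance between $\omega_1$ and $\omega_2$, i.e. if and only if $\omega_1n_2-\omega_2n_1\neq0$; 2. if they have the same sign, $\omega_1\omega_2>0$, then $x_e$ is formally stable. -/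

import Mathlib

open scoped Manifold ContDiff Topology

noncomputable section

namespace AxiRE

/-! ### The symmetry group `SO(2) ⋉ ℝ³ × SO(2)` -/

abbrev R3 : Type := EuclideanSpace ℝ (Fin 3)

/-- The rotation `exp(φ ê₃)` of `ℝ³` about the third axis. -/
def rotate (φ : Real.Angle) (a : R3) : R3 :=
  !₂[φ.cos * a 0 - φ.sin * a 1, φ.sin * a 0 + φ.cos * a 1, a 2]

/-- Elements `(φ, a, θ)` of `SO(2)_L ⋉ ℝ³ × SO(2)_R`. -/
@[ext] structure EGroup : Type where
  rot : Real.Angle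
  trans : R3
  spin : Real.Angle

namespace EGroup

instance : Mul EGroup :=
  ⟨fun g h => ⟨g.rot + h.rot, g.trans + rotate g.rot h.trans, g.spin + h.spin⟩⟩
instance : One EGroup := ⟨⟨0, 0, 0⟩⟩
instance : Inv EGroup := ⟨fun g => ⟨-g.rot, -rotate (-g.rot) g.trans, -g.spin⟩⟩

theorem mul_def (g h : EGroup) :
    g * h = ⟨g.rot + h.rot, g.trans + rotate g.rot h.trans, g.spin + h.spin⟩ := rfl
theorem one_def : (1 : EGroup) = ⟨0, 0, 0⟩ := rfl
theorem inv_def (g : EGroup) : g⁻¹ = ⟨-g.rot, -rotate (-g.rot) g.trans, -g.spin⟩ := rfl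

instance : Group EGroup :=
  Group.ofLeftAxioms
    (by
      intro a b c
      ext i
      · exact add_assoc _ _ _
      · fin_cases i <;>
          simp [mul_def, rotate, Real.Angle.cos_add, Real.Angle.sin_add] <;> ring
      · exact add_assoc _ _ _)
    (by
      intro a
      ext i
      · exact zero_add _
      · fin_cases i <;> simp [mul_def, one_def, rotate]
      · exact zero_add _)
    (by
      intro a
      ext i
      · exact neg_add_cancel _
      · fin_cases i <;> simp [mul_def, one_def, inv_def, rotate]
      · exact neg_add_cancel _)

/-- The topology of the product `SO(2) × ℝ³ × SO(2)`. -/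
instance : TopologicalSpace EGroup :=
  TopologicalSpace.induced
    (fun g : EGroup => ((g.rot, g.trans, g.spin) : Real.Angle × R3 × Real.Angle)) inferInstance

/-- The Lie algebra `so(2) ⊕ ℝ³ ⊕ so(2)`; by the standard coordinates it is also its own dual. -/
abbrev LieAlg : Type := ℝ × R3 × ℝ

/-- The covering map `ℝ × ℝ³ × ℝ → SO(2) ⋉ ℝ³ × SO(2)`.  It is a local diffeomorphism which sends
`0` to the identity, and its derivative at `0` is the identity of the Lie algebra. -/
def ofReal (ξ : LieAlg) : EGroup := ⟨(ξ.1 : Real.Angle), ξ.2.1, (ξ.2.2 : Real.Angle)⟩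

/-- The element `(φ, 0, φ)` of the diagonal subgroup `SO(2)_D`. -/
def diag (φ : Real.Angle) : EGroup := ⟨φ, 0, φ⟩

/-- The adjoint action `Ad_g ξ = g ξ g⁻¹`. -/
def Ad (g : EGroup) (ξ : LieAlg) : LieAlg :=
  (ξ.1, rotate g.rot ξ.2.1 - ξ.1 • !₂[-g.trans 1, g.trans 0, 0], ξ.2.2)

/-- The pairing of the dual of the Lie algebra with the Lie algebra. -/
def pair (μ ξ : LieAlg) : ℝ := μ.1 * ξ.1 + inner ℝ μ.2.1 ξ.2.1 + μ.2.2 * ξ.2.2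

end EGroup

open EGroup

/-! ### Hamiltonian systems on a 12-dimensional phase space with this symmetry -/

/-- The model space of a 12-dimensional phase space. -/
abbrev E12 : Type := EuclideanSpace ℝ (Fin 12)

section System

variable (M : Type*) [TopologicalSpace M] [ChartedSpace E12 M]

/-- A differential 2-form (not necessarily smooth). -/
abbrev TwoForm : Type _ := (x : M) → TangentSpace (𝓡 12) x [⋀^Fin 2]→L[ℝ] ℝ

variable {M}

/-- The coordinate expression of a 2-form in the chart at `x₀`. -/
def TwoForm.inChart (Ω : TwoForm M) (x₀ : M) (y : E12) : E12 [⋀^Fin 2]→L[ℝ] ℝ :=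
  (Ω ((extChartAt (𝓡 12) x₀).symm y)).compContinuousLinearMap
    (mfderiv 𝓘(ℝ, E12) (𝓡 12) (extChartAt (𝓡 12) x₀).symm y)

/-- A symplectic form: a smooth, closed, nondegenerate 2-form. -/
structure IsSymplectic (Ω : TwoForm M) : Prop where
  smooth : ∀ x₀ : M, ContDiffOn ℝ ∞ (Ω.inChart x₀) (extChartAt (𝓡 12) x₀).target
  closed : ∀ x₀ : M, ∀ y ∈ (extChartAt (𝓡 12) x₀).target, extDeriv (Ω.inChart x₀) y = 0
  nondegenerate : ∀ (x : M) (u : TangentSpace (𝓡 12) x),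
    (∀ v : TangentSpace (𝓡 12) x, Ω x ![u, v] = 0) → u = 0

variable [MulAction EGroup M]

/-- The tangent vector `ξ x`, i.e. the derivative at `t = 0` of `exp(t ξ) x`. -/
def generator (ξ : LieAlg) (x : M) : TangentSpace (𝓡 12) x :=
  (mfderiv 𝓘(ℝ, LieAlg) (𝓡 12) (fun η : LieAlg => ofReal η • x) 0 : LieAlg →L[ℝ] E12) ξ

variable (M)

/-- A Hamiltonian system on `M` with symmetry group `SO(2) ⋉ ℝ³ × SO(2)`: a smooth symplectic
action, an invariant Hamiltonian `H`, and a momentum map `J = (J^φ, J^a, J^θ)` which transforms by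
the coadjoint action. -/
structure HamSystem where
  Ω : TwoForm M
  symplectic : IsSymplectic Ω
  smooth_action : ContMDiff (𝓘(ℝ, LieAlg).prod (𝓡 12)) (𝓡 12) ∞
    (fun p : LieAlg × M => ofReal p.1 • p.2)
  Ω_invariant : ∀ (g : EGroup) (x : M),
    (Ω (g • x)).compContinuousLinearMap (mfderiv (𝓡 12) (𝓡 12) (fun y : M => g • y) x) = Ω x
  H : M → ℝ
  H_smooth : ContMDiff (𝓡 12) 𝓘(ℝ, ℝ) ∞ H
  H_invariant : ∀ (g : EGroup) (x : M), H (g • x) = H x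
  J : M → LieAlg
  J_smooth : ContMDiff (𝓡 12) 𝓘(ℝ, LieAlg) ∞ J
  J_momentum : ∀ (x : M) (ξ : LieAlg) (v : TangentSpace (𝓡 12) x),
    Ω x ![generator ξ x, v] = mfderiv (𝓡 12) 𝓘(ℝ, ℝ) (fun y => pair (J y) ξ) x v
  J_equivariant : ∀ (g : EGroup) (x : M) (ξ : LieAlg), pair (J (g • x)) (Ad g ξ) = pair (J x) ξ

/-! ### The 4-dimensional reduced space -/

/-- The linear symplectic space `W = ℝ⁴`, with coordinates `(q₁, q₂, p₁, p₂)`. -/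
abbrev W4 : Type := EuclideanSpace ℝ (Fin 4)

/-- The standard symplectic form `dq ∧ dp`. -/
def Ω₀ (u v : W4) : ℝ := u 0 * v 2 + u 1 * v 3 - u 2 * v 0 - u 3 * v 1

/-- The standard symplectic structure matrix `𝕁 (q, p) = (p, -q)`. -/
def JJ (u : W4) : W4 := !₂[u 2, u 3, -u 0, -u 1]

/-- The matrix of second derivatives at `0`, as a bilinear form. -/
def hessian (f : W4 → ℝ) (u v : W4) : ℝ := fderiv ℝ (fderiv ℝ f) 0 u v

/-- The real bilinear form is positive or negative definite. -/
def IsDefinite (B : W4 → W4 → ℝ) : Prop :=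
  (∀ u, u ≠ 0 → 0 < B u u) ∨ (∀ u, u ≠ 0 → B u u < 0)

/-- All complex eigenvalues are nonzero and purely imaginary. -/
def IsEllipticMap (A : W4 →L[ℝ] W4) : Prop :=
  ∀ z : ℂ, ((LinearMap.charpoly (A : W4 →ₗ[ℝ] W4)).map (algebraMap ℝ ℂ)).IsRoot z →
    z.re = 0 ∧ z ≠ 0

/-- `e, f` is a basis with the standard symplectic structure of the plane `P`. -/
def IsSymplecticPlaneBasis (P : Submodule ℝ W4) (e f : W4) : Prop :=
  Submodule.span ℝ {e, f} = P ∧ Ω₀ e f = 1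

/-- The plane `P` is invariant under `A`, and for a symplectic basis of `P` the map `A` is the
Hamiltonian vector field of `om * (q² + p²) / 2`.  So `P` is a real `±i om` eigenspace, where the sign
of the frequency `om` is the Krein sign. -/
def HasFrequency (A : W4 →L[ℝ] W4) (P : Submodule ℝ W4) (om : ℝ) : Prop :=
  ∃ e f : W4, IsSymplecticPlaneBasis P e f ∧ A e = -(om • f) ∧ A f = om • e

/-- The plane `P` is invariant under the linear circle action `L`, and for a symplectic basis of
`P` the action is `z ↦ e^{inφ} z` with momentum map `n |z|² / 2 = n (q² + p²) / 2`. -/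
def HasType (L : Real.Angle → W4 →L[ℝ] W4) (P : Submodule ℝ W4) (n : ℤ) : Prop :=
  ∃ e f : W4, IsSymplecticPlaneBasis P e f ∧ ∀ φ : Real.Angle,
    L φ e = (n • φ).cos • e - (n • φ).sin • f ∧ L φ f = (n • φ).sin • e + (n • φ).cos • f

variable {M}

/-- The derivative at `w = 0` of a parametrization `σ`, read in the model space `E12`, to which every
tangent space of `M` is equal by definition. -/
def deriv₀ (σ : W4 → M) : W4 →L[ℝ] E12 := mfderiv 𝓘(ℝ, W4) (𝓡 12) σ 0

/-- `L` is the linearization at `w = 0` of the action of `SO(2)_D` on the reduced space with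
coordinates `w ↦ σ w`, where `σ 0 = x`: the derivative of `w ↦ (φ, 0, φ) σ(w)` at `w = 0` agrees
with that of `σ ∘ L φ` up to vectors which are tangent to the `K`-orbit of `x`. -/
def IsLinearizedAction (x : M) (σ : W4 → M) (L : Real.Angle → W4 →L[ℝ] W4) : Prop :=
  ∀ (φ : Real.Angle) (u : W4), ∃ (a : R3) (θ : ℝ),
    deriv₀ (fun w => diag φ • σ w) u - deriv₀ σ (L φ u) = generator (0, a, θ) x

namespace HamSystem

variable (S : HamSystem M) (x : M)

/-- `x` is a relative equilibrium: the Hamiltonian vector field `f_H`, which is determined by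
`Ω (f_H, v) = DH v`, takes at `x` the value `ξ x` for some `ξ` in the Lie algebra (so that
`exp(t ξ) x` is a solution). -/
def IsRelativeEquilibrium : Prop :=
  ∃ ξ : LieAlg, ∀ v : TangentSpace (𝓡 12) x,
    S.Ω x ![generator ξ x, v] = mfderiv (𝓡 12) 𝓘(ℝ, ℝ) S.H x v

/-- `x` is a relative equilibrium whose isotropy subgroup is the diagonal `SO(2)_D`. -/
structure IsAxisymmetricRE : Prop where
  relEq : S.IsRelativeEquilibrium x
  isotropy : ∀ g : EGroup, g • x = x ↔ ∃ φ : Real.Angle, g = diag φ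

/-- `w ↦ σ w` are canonical coordinates near `x` on the symplectic reduced space of the abelian
subgroup `K = ℝ³ × SO(2)_R = {(0, a, θ)}` at the momentum of `x`: the map `σ` is, near `w = 0`, a
smooth symplectic parametrization of a surface in the level set of `J^K = (J^a, J^θ)` through `x`.
The tangent space of the `K`-orbit is the kernel of `Ω` on the tangent space of this level set, so
the surface is automatically transverse to the `K`-orbit and is a local model of the reduced
space. -/
structure IsReducedCoords (σ : W4 → M) : Prop where
  zero : σ 0 = x
  exists_nhds : ∃ U : Set W4, IsOpen U ∧ (0 : W4) ∈ U ∧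
    ContMDiffOn 𝓘(ℝ, W4) (𝓡 12) ∞ σ U ∧
    ∀ w ∈ U, (S.J (σ w)).2 = (S.J x).2 ∧
      ∀ u v : W4, S.Ω (σ w) ![mfderiv 𝓘(ℝ, W4) (𝓡 12) σ w u, mfderiv 𝓘(ℝ, W4) (𝓡 12) σ w v]
        = Ω₀ u v

/-- The reduced Hamiltonian `w ↦ H(ν_e, w)`. -/
def redH (σ : W4 → M) (w : W4) : ℝ := S.H (σ w)

/-- The momentum `J_W = J^φ + J^θ` of `SO(2)_D` in the reduced coordinates. -/
def redJ (σ : W4 → M) (w : W4) : ℝ := (S.J (σ w)).1 + (S.J (σ w)).2.2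

/-- The linearization at `w = 0` of the reduced system `ẇ = 𝕁 D_w H(ν_e, w)`. -/
def linearization (σ : W4 → M) : W4 →L[ℝ] W4 :=
  fderiv ℝ (fun w => JJ (gradient (S.redH σ) w)) 0

/-- The equilibrium `w = 0` of the reduced system is elliptic. -/
def IsElliptic : Prop :=
  ∃ σ : W4 → M, S.IsReducedCoords x σ ∧ IsEllipticMap (S.linearization σ)

/-- The linearization of the reduced system at `w = 0` is semisimple. -/
def IsSemisimple : Prop :=
  ∃ σ : W4 → M, S.IsReducedCoords x σ ∧
    Module.End.IsSemisimple (S.linearization σ : Module.End ℝ W4)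

/-- The Hessian of `H + c J_W` on `W` is definite for some real `c`. -/
def IsFormallyStable : Prop :=
  ∃ σ : W4 → M, S.IsReducedCoords x σ ∧
    ∃ c : ℝ, IsDefinite (hessian (fun w => S.redH σ w + c * S.redJ σ w))

/-- `om 0, om 1` are the two (signed) normal frequencies, and the action of `SO(2)_D` is of type
`n j` on the real `±i om j` eigenspace: `W` is the symplectically orthogonal sum of two planes that
are invariant under the linearized system and under the linearized action, where the plane number
`j` has the frequency `om j` and the type `n j`. -/
def HasNormalFrequencies (om : Fin 2 → ℝ) (n : Fin 2 → ℤ) : Prop :=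
  ∃ σ : W4 → M, S.IsReducedCoords x σ ∧
    ∃ L : Real.Angle → W4 →L[ℝ] W4, IsLinearizedAction x σ L ∧
      ∃ P : Fin 2 → Submodule ℝ W4, IsCompl (P 0) (P 1) ∧
        (∀ u ∈ P 0, ∀ v ∈ P 1, Ω₀ u v = 0) ∧
        ∀ j, HasFrequency (S.linearization σ) (P j) (om j) ∧ HasType L (P j) (n j)

end HamSystem

end System

end AxiRE

end

open scoped Manifold ContDiff Topology

noncomputable section

namespace AxiRE

open EGroup

/-! ### Symplectic linear algebra on `W` -/

section SymplecticForm

/-! Everything is decided by linear algebra on the symplectic space `W`. It carries the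
linearization A, the linearized circle action L and the generator B of L. Both A and B are skew for
`Ω₀`, they commute, and Ω₀(A u, v) = D²H(u, v), Ω₀(B u, v) = D²J_W(u, v). The Hessian of H + c J_W
is therefore the quadratic form of A + cB. On a plane with frequency ω_j and type n_j it equals (ω_j
+ c n_j)(q² + p²) in suitable symplectic coordinates (`exists_diagonal_basis`), so it is definite
exactly when the two coefficients are nonzero and of equal sign (`quadratic_form_definite_iff`).
Frequencies of equal sign allow c = 0. For opposite signs a suitable c exists if and only if ω₁n₂ -
ω₂n₁ ≠ 0 (`exists_mul_pos_iff`).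

Existence of frequencies and types (`exists_normal_form`): A and B have a common complex
eigenvector, hence a real vector e with A²e = -α²e and Be = be + sAe. Periodicity of L rules out b ≠
0 and Jordan blocks of B - sA, and semisimplicity rules out those of A² + α². If Ω₀(e, Ae) vanished
for every common vector of this kind, one of them would satisfy Ae = 0, against ellipticity. So some
plane spanned by e and Ae is symplectic, and its symplectic complement is the other plane.

The geometric input is threefold. Two slices through x differ to first order by a symplectic map T,
up to vectors tangent to the K-orbit (`exists_isTransition`). T carries Hessians to Hessians,
because at a critical point of an augmented function second derivatives see only first derivatives
(`IsTransition.hessian_eq`). The translate of a slice by an element of SO(2)_D is again a slice, so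
each L(φ) is itself such a T. Finally D²J_W is the form of B because the generator of SO(2)_D
vanishes at x (`IsReducedCoords.hessian_redJ_eq`). -/

theorem Ω₀_add_left (u v w : W4) : Ω₀ (u + v) w = Ω₀ u w + Ω₀ v w := by
  simp [Ω₀]; ring

theorem Ω₀_add_right (u v w : W4) : Ω₀ u (v + w) = Ω₀ u v + Ω₀ u w := by
  simp [Ω₀]; ring

theorem Ω₀_smul_left (c : ℝ) (u v : W4) : Ω₀ (c • u) v = c * Ω₀ u v := by
  simp [Ω₀]; ring

theorem Ω₀_smul_right (c : ℝ) (u v : W4) : Ω₀ u (c • v) = c * Ω₀ u v := by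
  simp [Ω₀]; ring

theorem Ω₀_neg_left (u v : W4) : Ω₀ (-u) v = -Ω₀ u v := by
  simp [Ω₀]; ring

theorem Ω₀_neg_right (u v : W4) : Ω₀ u (-v) = -Ω₀ u v := by
  simp [Ω₀]; ring

theorem Ω₀_sub_left (u v w : W4) : Ω₀ (u - v) w = Ω₀ u w - Ω₀ v w := by
  simp [Ω₀]; ring

theorem Ω₀_sub_right (u v w : W4) : Ω₀ u (v - w) = Ω₀ u v - Ω₀ u w := by
  simp [Ω₀]; ring

theorem Ω₀_zero_left (u : W4) : Ω₀ 0 u = 0 := by simp [Ω₀]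

theorem Ω₀_self (u : W4) : Ω₀ u u = 0 := by simp [Ω₀]; ring

theorem Ω₀_swap (u v : W4) : Ω₀ u v = -Ω₀ v u := by simp [Ω₀]; ring

theorem Ω₀_JJ (u v : W4) : Ω₀ (JJ u) v = inner ℝ u v := by
  simp [Ω₀, JJ, PiLp.inner_apply, Fin.sum_univ_four]; ring

theorem JJ_JJ (u : W4) : JJ (JJ u) = -u := by
  ext i; fin_cases i <;> simp [JJ]

theorem Ω₀_nondegenerate {u : W4} (h : ∀ v, Ω₀ u v = 0) : u = 0 := by
  have h1 := Ω₀_JJ (-JJ u) u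
  have h2 : JJ (-JJ u) = u := by ext i; fin_cases i <;> simp [JJ]
  have h3 : inner ℝ (-JJ u) (-JJ u) = (0 : ℝ) := by rw [← Ω₀_JJ, h2, h]
  have h4 : JJ u = 0 := by simpa using inner_self_eq_zero.mp h3
  have h5 := JJ_JJ u
  rw [h4] at h5
  have h6 : JJ 0 = 0 := by ext i; fin_cases i <;> simp [JJ]
  rw [h6] at h5
  exact neg_eq_zero.mp h5.symm

theorem Ω₀_ext {u v : W4} (h : ∀ w, Ω₀ u w = Ω₀ v w) : u = v :=
  sub_eq_zero.mp (Ω₀_nondegenerate fun w => by rw [Ω₀_sub_left, h, sub_self])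

theorem hasDerivAt_Ω₀ {f g : ℝ → W4} {f' g' : W4} {t : ℝ} (hf : HasDerivAt f f' t)
    (hg : HasDerivAt g g' t) :
    HasDerivAt (fun s => Ω₀ (f s) (g s)) (Ω₀ f' (g t) + Ω₀ (f t) g') t := by
  have hf' (i : Fin 4) : HasDerivAt (fun s => f s i) (f' i) t :=
    (EuclideanSpace.proj i : W4 →L[ℝ] ℝ).hasFDerivAt.comp_hasDerivAt t hf
  have hg' (i : Fin 4) : HasDerivAt (fun s => g s i) (g' i) t :=
    (EuclideanSpace.proj i : W4 →L[ℝ] ℝ).hasFDerivAt.comp_hasDerivAt t hg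
  refine (((((hf' 0).mul (hg' 2)).add ((hf' 1).mul (hg' 3))).sub ((hf' 2).mul (hg' 0))).sub
    ((hf' 3).mul (hg' 1))).congr_deriv ?_
  simp only [Ω₀]; ring

/-- The standard symplectic form as a bilinear form. -/
def ΩB : LinearMap.BilinForm ℝ W4 :=
  LinearMap.mk₂ ℝ Ω₀ Ω₀_add_left Ω₀_smul_left Ω₀_add_right Ω₀_smul_right

theorem Ω₀_surjective (l : W4 →ₗ[ℝ] ℝ) : ∃ u : W4, ∀ v, Ω₀ u v = l v := by
  have h : Function.Injective ΩB := by
    rw [← LinearMap.ker_eq_bot, LinearMap.ker_eq_bot']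
    intro u hu
    exact Ω₀_nondegenerate fun v => by simpa [ΩB] using LinearMap.congr_fun hu v
  have h2 := (LinearMap.injective_iff_surjective_of_finrank_eq_finrank
    (f := ΩB) (by simp)).mp h
  obtain ⟨u, hu⟩ := h2 l
  exact ⟨u, fun v => by simpa [ΩB] using LinearMap.congr_fun hu v⟩

end SymplecticForm

/-! ### Common eigenvectors of commuting endomorphisms -/

section Spectral

variable {A B : W4 →L[ℝ] W4}

theorem IsEllipticMap.eq_zero_of_apply_eq_smul (hA : IsEllipticMap A) {r : ℝ} {u : W4}
    (hu : A u = r • u) : u = 0 := by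
  by_contra hne
  have h1 : Module.End.HasEigenvalue (A : W4 →ₗ[ℝ] W4) r :=
    Module.End.hasEigenvalue_of_hasEigenvector (x := u)
      ⟨Module.End.mem_eigenspace_iff.mpr hu, hne⟩
  rw [Module.End.hasEigenvalue_iff_isRoot_charpoly] at h1
  have h2 := hA (r : ℂ) (h1.map (f := algebraMap ℝ ℂ))
  obtain ⟨h3, h4⟩ := h2
  simp only [Complex.ofReal_re] at h3
  exact h4 (by simp [h3])

/-- Two commuting complex endomorphisms have a common eigenvector for each eigenvalue of the
first. -/
theorem exists_common_eigenvector {V : Type*} [AddCommGroup V] [Module ℂ V]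
    [FiniteDimensional ℂ V] {f g : Module.End ℂ V} (h : Commute f g) {z : ℂ}
    (hz : f.HasEigenvalue z) : ∃ (w : ℂ) (v : V), v ≠ 0 ∧ f v = z • v ∧ g v = w • v := by
  have hmaps : ∀ v ∈ f.eigenspace z, g v ∈ f.eigenspace z := by
    intro v hv
    rw [Module.End.mem_eigenspace_iff] at hv ⊢
    have := LinearMap.congr_fun h.eq v
    simp only [Module.End.mul_apply] at this
    rw [this, hv, map_smul]
  have : Nontrivial (f.eigenspace z) := (Submodule.nontrivial_iff_ne_bot).mpr hz
  obtain ⟨w, hw⟩ := Module.End.exists_eigenvalue (g.restrict hmaps)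
  obtain ⟨v, hv⟩ := hw.exists_hasEigenvector
  refine ⟨w, v, fun h0 => hv.2 (Subtype.ext h0), Module.End.mem_eigenspace_iff.mp v.2, ?_⟩
  simpa using congrArg Subtype.val hv.apply_eq_smul

/-- A real common invariant plane of two commuting endomorphisms, the first elliptic. -/
theorem IsEllipticMap.exists_common_plane (hA : IsEllipticMap A)
    (hAB : ∀ u, A (B u) = B (A u)) :
    ∃ (α b s : ℝ) (e : W4), α ≠ 0 ∧ e ≠ 0 ∧ A (A e) = -(α ^ 2 • e) ∧ B e = b • e + s • A e := by
  let bas := (EuclideanSpace.basisFun (Fin 4) ℝ).toBasis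
  let M (X : W4 →L[ℝ] W4) : Matrix (Fin 4) (Fin 4) ℝ := LinearMap.toMatrix bas bas X
  let MC (X : W4 →L[ℝ] W4) : Matrix (Fin 4) (Fin 4) ℂ := (M X).map (algebraMap ℝ ℂ)
  have hM (X : W4 →L[ℝ] W4) (u : W4) (i : Fin 4) : X u i = ∑ j, M X i j * u j := by
    have := congrFun (LinearMap.toMatrix_mulVec_repr bas bas X u) i
    simpa [bas, M, Matrix.mulVec, dotProduct] using this.symm
  let re (v : Fin 4 → ℂ) : W4 := WithLp.toLp 2 fun i => (v i).re
  let im (v : Fin 4 → ℂ) : W4 := WithLp.toLp 2 fun i => (v i).im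
  -- The matrices are real, so they commute with taking real and imaginary parts.
  have hre (X : W4 →L[ℝ] W4) (v : Fin 4 → ℂ) : X (re v) = re ((MC X).mulVec v) := by
    ext i
    rw [hM]
    simp [re, MC, Matrix.mulVec, dotProduct]
  have him (X : W4 →L[ℝ] W4) (v : Fin 4 → ℂ) : X (im v) = im ((MC X).mulVec v) := by
    ext i
    rw [hM]
    simp [im, MC, Matrix.mulVec, dotProduct]
  have hcomm : Commute (Matrix.toLin' (MC A)) (Matrix.toLin' (MC B)) := by
    have h1 : M A * M B = M B * M A := by
      simp only [M]
      rw [← LinearMap.toMatrix_comp, ← LinearMap.toMatrix_comp]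
      congr 1
      ext1 u
      exact hAB u
    have h2 : MC A * MC B = MC B * MC A := by
      simp only [MC]
      rw [← Matrix.map_mul, h1, Matrix.map_mul]
    show _ * _ = _ * _
    rw [Module.End.mul_eq_comp, Module.End.mul_eq_comp, ← Matrix.toLin'_mul, h2, Matrix.toLin'_mul]
  obtain ⟨z, hz⟩ := Module.End.exists_eigenvalue (Matrix.toLin' (MC A))
  have hroot : ((LinearMap.charpoly (A : W4 →ₗ[ℝ] W4)).map (algebraMap ℝ ℂ)).IsRoot z := by
    rw [Module.End.hasEigenvalue_iff_isRoot_charpoly, Matrix.charpoly_toLin'] at hz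
    rwa [← LinearMap.charpoly_toMatrix (A : W4 →ₗ[ℝ] W4) bas, ← Matrix.charpoly_map]
  obtain ⟨hz0, hzne⟩ := hA z hroot
  obtain ⟨w, v, hv, hAv, hBv⟩ := exists_common_eigenvector hcomm hz
  rw [Matrix.toLin'_apply] at hAv hBv
  have hα : z.im ≠ 0 := fun h => hzne (Complex.ext hz0 h)
  have h1 : A (re v) = -(z.im • im v) := by
    rw [hre, hAv]; ext i; simp [re, im, hz0]
  have h2 : A (im v) = z.im • re v := by
    rw [him, hAv]; ext i; simp [re, im, hz0]
  have h3 : B (re v) = w.re • re v - w.im • im v := by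
    rw [hre, hBv]; ext i; simp [re, im]
  -- The value of A on the real part gives im v = -(A (re v)) / α with α = z.im. Eliminating im v
  -- from B (re v) produces s = w.im / α.
  refine ⟨z.im, w.re, w.im / z.im, re v, hα, ?_, ?_, ?_⟩
  · intro h0
    rw [h0, map_zero] at h1
    have h4 : im v = 0 := by simpa [hα] using h1
    apply hv
    funext i
    have h5 := congrArg (fun u : W4 => u i) h0
    have h6 := congrArg (fun u : W4 => u i) h4
    exact Complex.ext (by simpa [re] using h5) (by simpa [im] using h6)
  · rw [h1, map_neg, map_smul, h2, smul_smul, pow_two]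
  · rw [h3, h1, smul_neg, smul_smul, div_mul_cancel₀ _ hα, sub_eq_add_neg]

end Spectral

/-! ### Periodicity of the circle action and its spectral consequences -/

section CircleAction

/-- A symplectic linear action of the circle on `W`, with its infinitesimal generator `B`. -/
structure IsCircleAction (L : Real.Angle → W4 →L[ℝ] W4) (B : W4 →L[ℝ] W4) : Prop where
  apply_zero : L 0 = ContinuousLinearMap.id ℝ W4
  apply_add : ∀ φ ψ u, L (φ + ψ) u = L φ (L ψ u)
  symplectic : ∀ φ u v, Ω₀ (L φ u) (L φ v) = Ω₀ u v
  hasDerivAt : ∀ u, HasDerivAt (fun t : ℝ => L (t : Real.Angle) u) (B u) 0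

namespace IsCircleAction

variable {L : Real.Angle → W4 →L[ℝ] W4} {B : W4 →L[ℝ] W4}

theorem skew (h : IsCircleAction L B) (u v : W4) : Ω₀ (B u) v = -Ω₀ u (B v) := by
  have h1 := hasDerivAt_Ω₀ (h.hasDerivAt u) (h.hasDerivAt v)
  simp only [h.symplectic] at h1
  have h2 := h1.unique (hasDerivAt_const (0 : ℝ) (Ω₀ u v))
  simp only [Real.Angle.coe_zero, h.apply_zero, ContinuousLinearMap.id_apply] at h2
  linarith

theorem hasDerivAt_real (h : IsCircleAction L B) (u : W4) (t : ℝ) :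
    HasDerivAt (fun t : ℝ => L (t : Real.Angle) u) (B (L t u)) t := by
  have h1 := h.hasDerivAt (L t u)
  have h2 : HasDerivAt (fun s : ℝ => s - t) 1 t := (hasDerivAt_id t).sub_const t
  have h3 := HasDerivAt.scomp (h := fun s : ℝ => s - t) t (by simpa using h1) h2
  rw [one_smul] at h3
  refine h3.congr_of_eventuallyEq (Filter.Eventually.of_forall fun s => ?_)
  simp only [Function.comp]
  rw [← h.apply_add, ← Real.Angle.coe_add, sub_add_cancel]

/-- Solutions of `z' = B z` are given by the action. -/
theorem eq_of_hasDerivAt (h : IsCircleAction L B) {z : ℝ → W4}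
    (hz : ∀ t, HasDerivAt z (B (z t)) t) (t : ℝ) : z t = L t (z 0) := by
  -- Pairing z with an orbit of the action gives a constant, because B is skew; nondegeneracy then
  -- identifies z with an orbit.
  have h1 (w : W4) (s : ℝ) : HasDerivAt (fun s : ℝ => Ω₀ (z s) (L (s : Real.Angle) w)) 0 s := by
    have := hasDerivAt_Ω₀ (hz s) (h.hasDerivAt_real w s)
    rwa [h.skew, neg_add_cancel] at this
  have h2 (w : W4) : Ω₀ (z t) (L t w) = Ω₀ (z 0) w := by
    have := is_const_of_deriv_eq_zero (fun s => (h1 w s).differentiableAt)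
      (fun s => (h1 w s).deriv) t 0
    simpa [h.apply_zero] using this
  refine Ω₀_ext fun w => ?_
  have h3 : w = L t (L (-t : Real.Angle) w) := by
    rw [← h.apply_add, add_neg_cancel, h.apply_zero, ContinuousLinearMap.id_apply]
  rw [h3, h2, h.symplectic]

variable {A : W4 →L[ℝ] W4}

/-- Explicit solution of `z' = B z` with a Jordan block of size at most two. -/
theorem jordan_solution (h : IsCircleAction L B) (hAB : ∀ u, A (B u) = B (A u))
    {α b s : ℝ} (hα : α ≠ 0) {u v : W4} (hu : A (A u) = -(α ^ 2 • u))
    (hv : A (A v) = -(α ^ 2 • v)) (hBu : B u = b • u + s • A u)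
    (hBv : B v = b • v + s • A v + u) (t : ℝ) :
    L t v = Real.exp (b * t) • (Real.cos (s * α * t) • (v + t • u) +
      (Real.sin (s * α * t) / α) • A (v + t • u)) := by
  have hBAu : B (A u) = b • A u + s • (-(α ^ 2 • u)) := by
    rw [← hAB, hBu, map_add, map_smul, map_smul, hu]
  have hBAv : B (A v) = b • A v + s • (-(α ^ 2 • v)) + A u := by
    rw [← hAB, hBv, map_add, map_add, map_smul, map_smul, hv]
  -- Here B = b + sA + N with Nv = u and Nu = 0, so the solution is e^{bt} e^{stA} (v + t u). On the
  -- kernel of A² + α² the factor e^{stA} is cos(sαt) + (sin(sαt)/α) A.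
  set z : ℝ → W4 := fun t => Real.exp (b * t) • (Real.cos (s * α * t) • (v + t • u) +
      (Real.sin (s * α * t) / α) • A (v + t • u)) with hzdef
  have hz : ∀ t, HasDerivAt z (B (z t)) t := by
    intro t
    have hlin (c : ℝ) : HasDerivAt (fun t : ℝ => c * t) c t := by
      simpa using (hasDerivAt_id t).const_mul c
    have d1 : HasDerivAt (fun t : ℝ => Real.exp (b * t)) (Real.exp (b * t) * b) t :=
      (hlin b).exp
    have d2 : HasDerivAt (fun t : ℝ => Real.cos (s * α * t))
      (-Real.sin (s * α * t) * (s * α)) t := (hlin (s * α)).cos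
    have d3 : HasDerivAt (fun t : ℝ => Real.sin (s * α * t) / α)
      (Real.cos (s * α * t) * (s * α) / α) t := ((hlin (s * α)).sin).div_const α
    have d4 : HasDerivAt (fun t : ℝ => v + t • u) ((1 : ℝ) • u) t :=
      ((hasDerivAt_id t).smul_const u).const_add v
    have d5 : HasDerivAt (fun t : ℝ => A (v + t • u)) (A ((1 : ℝ) • u)) t :=
      A.hasFDerivAt.comp_hasDerivAt t d4
    refine (d1.smul ((d2.smul d4).add (d3.smul d5))).congr_deriv ?_
    simp only [hzdef, Pi.add_apply, Pi.smul_apply', map_add, map_smul, hBu, hBv, hBAu, hBAv]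
    match_scalars <;> field_simp <;> ring
  have := h.eq_of_hasDerivAt hz t
  simpa [hzdef] using this.symm

theorem coe_two_pi (h : IsCircleAction L B) (u : W4) :
    L ((2 * Real.pi : ℝ) : Real.Angle) u = u := by
  rw [Real.Angle.coe_two_pi, h.apply_zero, ContinuousLinearMap.id_apply]

end IsCircleAction

/-- A norm that is invariant under rotations in the planes spanned by `w` and `A w`. -/
theorem rotation_norm {A : W4 →L[ℝ] W4} {α c d : ℝ} (hα : α ≠ 0) {w : W4}
    (hw : A (A w) = -(α ^ 2 • w)) (hcd : c ^ 2 + d ^ 2 = 1) :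
    α ^ 2 * inner ℝ (c • w + (d / α) • A w) (c • w + (d / α) • A w)
      + inner ℝ (A (c • w + (d / α) • A w)) (A (c • w + (d / α) • A w))
      = α ^ 2 * inner ℝ w w + (inner ℝ (A w) (A w) : ℝ) := by
  simp only [map_add, map_smul, hw, inner_add_left, inner_add_right, inner_smul_left,
    inner_smul_right, inner_neg_left, inner_neg_right, real_inner_comm w (A w)]
  simp only [conj_trivial]
  field_simp
  linear_combination (α ^ 2 * inner ℝ w w + (inner ℝ (A w) (A w) : ℝ)) * hcd

namespace IsCircleAction

variable {L : Real.Angle → W4 →L[ℝ] W4} {A B : W4 →L[ℝ] W4}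

/-- After time 2π the action is the identity, while the explicit solution multiplies the
rotation-invariant energy α²|w|² + |Aw|² of e by e^{4πb}. -/
theorem re_eq_zero (h : IsCircleAction L B) (hAB : ∀ u, A (B u) = B (A u))
    {α b s : ℝ} (hα : α ≠ 0) {e : W4} (he : e ≠ 0) (hAe : A (A e) = -(α ^ 2 • e))
    (hBe : B e = b • e + s • A e) : b = 0 := by
  have h1 := h.jordan_solution hAB hα (u := 0) (v := e) (by simp) hAe (by simp) (by simpa using hBe)
    (2 * Real.pi)
  rw [h.coe_two_pi, smul_zero, add_zero] at h1
  have h2 := rotation_norm hα hAe (Real.cos_sq_add_sin_sq (s * α * (2 * Real.pi)))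
  set r := Real.cos (s * α * (2 * Real.pi)) • e + (Real.sin (s * α * (2 * Real.pi)) / α) • A e
  set E := Real.exp (b * (2 * Real.pi))
  have h3 : α ^ 2 * inner ℝ e e + (inner ℝ (A e) (A e) : ℝ) =
      E ^ 2 * (α ^ 2 * inner ℝ e e + (inner ℝ (A e) (A e) : ℝ)) := by
    rw [← h2]
    conv_lhs => rw [h2, h1, map_smul]
    simp only [inner_smul_left, inner_smul_right, conj_trivial]
    ring
  have h4 : 0 < α ^ 2 * inner ℝ e e + (inner ℝ (A e) (A e) : ℝ) := by
    have h5 : (0 : ℝ) < inner ℝ e e := real_inner_self_pos.mpr he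
    have h6 : (0 : ℝ) ≤ inner ℝ (A e) (A e) := real_inner_self_nonneg
    positivity
  have h5 : E ^ 2 = 1 := by
    have : (E ^ 2 - 1) * (α ^ 2 * inner ℝ e e + (inner ℝ (A e) (A e) : ℝ)) = 0 := by linarith
    rcases mul_eq_zero.mp this with h | h
    · linarith
    · exact absurd h h4.ne'
  have h6 : E = 1 := by
    have : 0 < E := Real.exp_pos _
    nlinarith
  have h7 : b * (2 * Real.pi) = 0 := Real.exp_eq_one_iff _ |>.mp h6
  simpa [Real.pi_ne_zero] using h7

/-- A Jordan block would make the orbit of v grow linearly, contradicting periodicity. With u the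
nilpotent part applied to v, the energy of v + t u equals that of v at t = 2π and at t = -2π; adding
the two identities isolates the energy of u, which must vanish. -/
theorem no_jordan_block (h : IsCircleAction L B) (hAB : ∀ u, A (B u) = B (A u))
    {α s : ℝ} (hα : α ≠ 0) {v : W4} (hv : A (A v) = -(α ^ 2 • v))
    (h2 : B (B v - s • A v) - s • A (B v - s • A v) = 0) : B v - s • A v = 0 := by
  set u := B v - s • A v with hu
  have hAu : A (A u) = -(α ^ 2 • u) := by
    rw [hu]
    simp only [map_sub, map_smul, hAB, hv, map_neg]
    module
  have key (t : ℝ) (ht : L (t : Real.Angle) v = v) :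
      2 * t * (α ^ 2 * inner ℝ v u + (inner ℝ (A v) (A u) : ℝ)) +
        t ^ 2 * (α ^ 2 * inner ℝ u u + (inner ℝ (A u) (A u) : ℝ)) = 0 := by
    have h1 := h.jordan_solution hAB hα (u := u) (v := v) (b := 0) (s := s) hAu hv
      (by simpa [sub_eq_zero] using h2) (by simp [hu]) t
    rw [ht, zero_mul, Real.exp_zero, one_smul] at h1
    have h3 := rotation_norm (A := A) (w := v + t • u) hα
      (by simp only [map_add, map_smul, hv, hAu]; module)
      (Real.cos_sq_add_sin_sq (s * α * t))
    rw [← h1] at h3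
    simp only [map_add, map_smul, inner_add_left, inner_add_right, inner_smul_left,
      inner_smul_right, conj_trivial, real_inner_comm v u, real_inner_comm (A v) (A u)] at h3
    linarith
  have k1 := key (2 * Real.pi) (h.coe_two_pi v)
  have k2 := key (-(2 * Real.pi)) (by
    rw [Real.Angle.coe_neg, Real.Angle.coe_two_pi, neg_zero, h.apply_zero,
      ContinuousLinearMap.id_apply])
  have k3 : α ^ 2 * inner ℝ u u + (inner ℝ (A u) (A u) : ℝ) = 0 := by
    have : (2 * Real.pi) ^ 2 * (α ^ 2 * inner ℝ u u + (inner ℝ (A u) (A u) : ℝ)) = 0 := by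
      linarith
    simpa [Real.pi_ne_zero] using this
  by_contra hne
  have h5 : (0 : ℝ) < inner ℝ u u := real_inner_self_pos.mpr hne
  have h6 : (0 : ℝ) ≤ inner ℝ (A u) (A u) := real_inner_self_nonneg
  have : 0 < α ^ 2 * inner ℝ u u := by positivity
  linarith

end IsCircleAction

end CircleAction

/-! ### Invariant symplectic planes and the common normal form -/

section Planes

/-- On an invariant subspace without Jordan blocks for the eigenvalue `0`, every vector is the sum
of a vector in the kernel and one in the range. -/
theorem exists_ker_add_range {V : Type*} [AddCommGroup V] [Module ℝ V] [FiniteDimensional ℝ V]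
    {X : V →ₗ[ℝ] V} {E : Submodule ℝ V} (hE : ∀ u ∈ E, X u ∈ E)
    (hX : ∀ u ∈ E, X (X u) = 0 → X u = 0) {u : V} (hu : u ∈ E) :
    ∃ k ∈ E, ∃ v ∈ E, X k = 0 ∧ u = k + X v := by
  let Y : E →ₗ[ℝ] E := X.restrict hE
  have hd : Disjoint (LinearMap.ker Y) (LinearMap.range Y) := by
    rw [Submodule.disjoint_def]
    rintro _ h1 ⟨v, rfl⟩
    rw [LinearMap.mem_ker] at h1
    exact Subtype.ext (hX v v.2 (congrArg Subtype.val h1))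
  have htop : LinearMap.ker Y ⊔ LinearMap.range Y = ⊤ := by
    refine Submodule.eq_top_of_disjoint _ _ ?_ hd
    rw [add_comm, LinearMap.finrank_range_add_finrank_ker]
  obtain ⟨k, hk, r, ⟨v, rfl⟩, hkr⟩ := Submodule.mem_sup.mp (htop ▸ Submodule.mem_top :
    (⟨u, hu⟩ : E) ∈ LinearMap.ker Y ⊔ LinearMap.range Y)
  refine ⟨k, k.2, v, v.2, congrArg Subtype.val (LinearMap.mem_ker.mp hk), ?_⟩
  exact (congrArg Subtype.val hkr).symm

variable {A B : W4 →L[ℝ] W4} {L : Real.Angle → W4 →L[ℝ] W4}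

/-- A polynomial in a semisimple endomorphism is semisimple, so for X² + α² the generalized kernel
is the kernel. -/
theorem sq_add_no_jordan_block (hss : Module.End.IsSemisimple (A : Module.End ℝ W4)) (α : ℝ)
    {v : W4} (hv : A (A (A (A v) + α ^ 2 • v)) + α ^ 2 • (A (A v) + α ^ 2 • v) = 0) :
    A (A v) + α ^ 2 • v = 0 := by
  let p : Polynomial ℝ := Polynomial.X ^ 2 + Polynomial.C (α ^ 2)
  let f : Module.End ℝ W4 := A
  have h1 : (Polynomial.aeval f p).IsSemisimple := hss.aeval p
  have h2 (u : W4) : Polynomial.aeval f p u = A (A u) + α ^ 2 • u := by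
    simp [p, f, pow_two, Module.algebraMap_end_apply, smul_smul]
  have h3 := h1.isFinitelySemisimple.genEigenspace_eq_eigenspace 0 (k := 2) (by norm_num)
  have h4 : v ∈ (Polynomial.aeval f p).genEigenspace 0 2 := by
    have := Module.End.mem_genEigenspace_nat (f := Polynomial.aeval f p) (μ := 0) (k := 2) (x := v)
    rw [show ((2 : ℕ) : ℕ∞) = 2 from rfl] at this
    rw [this, zero_smul, sub_zero, LinearMap.mem_ker, pow_two, Module.End.mul_apply, h2, h2]
    exact hv
  rw [h3, Module.End.mem_eigenspace_iff, zero_smul, h2] at h4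
  exact h4

/-- A common invariant symplectic plane of `A` and the circle action. -/
theorem exists_nondegenerate_vector (hL : IsCircleAction L B) (hAell : IsEllipticMap A)
    (hss : Module.End.IsSemisimple (A : Module.End ℝ W4)) (hAB : ∀ u, A (B u) = B (A u))
    (hskew : ∀ u v, Ω₀ (A u) v = -Ω₀ u (A v)) :
    ∃ (α s : ℝ) (e : W4), α ≠ 0 ∧ A (A e) = -(α ^ 2 • e) ∧ B e = s • A e ∧ Ω₀ e (A e) ≠ 0 := by
  obtain ⟨α, b, s, e₀, hα, he₀, hAe₀, hBe₀⟩ := hAell.exists_common_plane hAB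
  obtain rfl := hL.re_eq_zero hAB hα he₀ hAe₀ hBe₀
  rw [zero_smul, zero_add] at hBe₀
  by_contra! hcon
  let X : W4 →ₗ[ℝ] W4 := (A ∘L A + α ^ 2 • ContinuousLinearMap.id ℝ W4 : W4 →L[ℝ] W4)
  let Y : W4 →ₗ[ℝ] W4 := (B - s • A : W4 →L[ℝ] W4)
  have hX (u : W4) : X u = A (A u) + α ^ 2 • u := rfl
  have hY (u : W4) : Y u = B u - s • A u := rfl
  let E := LinearMap.ker X
  let F := E ⊓ LinearMap.ker Y
  have hE {u : W4} : u ∈ E ↔ A (A u) = -(α ^ 2 • u) := by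
    rw [LinearMap.mem_ker, hX, eq_neg_iff_add_eq_zero]
  have hYE : ∀ u ∈ E, Y u ∈ E := by
    intro u hu
    rw [hE] at hu ⊢
    simp only [hY, map_sub, map_smul, hAB, hu, map_neg]
    module
  have hquad : ∀ u ∈ F, Ω₀ u (A u) = 0 := by
    rintro u ⟨h1, h2⟩
    refine hcon α s u hα (hE.mp h1) ?_
    rwa [SetLike.mem_coe, LinearMap.mem_ker, hY, sub_eq_zero] at h2
  -- Polarization: skewness of A makes Ω₀(A u, v) symmetric in u and v.
  have hbil : ∀ u ∈ F, ∀ v ∈ F, Ω₀ (A u) v = 0 := by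
    intro u hu v hv
    have h1 := hquad (u + v) (F.add_mem hu hv)
    rw [map_add, Ω₀_add_left, Ω₀_add_right, Ω₀_add_right, hquad u hu, hquad v hv] at h1
    have h2 := hskew u v
    have h3 := Ω₀_swap v (A u)
    linarith
  have he₀F : e₀ ∈ F := ⟨hE.mpr hAe₀, by
    rw [SetLike.mem_coe, LinearMap.mem_ker, hY, hBe₀, sub_self]⟩
  -- Every w splits as k' + Yv' + Xv with k' in F. The first part is orthogonal to A e₀ by `hbil`.
  -- The others are too, since X is symmetric and Y is skew for `Ω₀`, and both annihilate A e₀.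
  have hzero : A e₀ = 0 := by
    refine Ω₀_nondegenerate fun w => ?_
    obtain ⟨k, -, v, -, hk, rfl⟩ := exists_ker_add_range (X := X) (E := ⊤) (by simp)
      (fun u _ hu => sq_add_no_jordan_block hss α hu) (Submodule.mem_top (x := w))
    obtain ⟨k', hk'E, v', -, hk', rfl⟩ := exists_ker_add_range (X := Y) (E := E) hYE
      (fun u hu h2 => hL.no_jordan_block hAB hα (hE.mp hu) h2) (u := k) hk
    rw [Ω₀_add_right, Ω₀_add_right, hbil e₀ he₀F k' ⟨hk'E, hk'⟩, hX, hY, Ω₀_sub_right,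
      Ω₀_smul_right, Ω₀_add_right, Ω₀_smul_right]
    have e1 := hskew (A e₀) v'
    have e2 := hL.skew (A e₀) v'
    have e3 := hskew (A e₀) (A v)
    have e4 := hskew (A (A e₀)) v
    rw [← hAB, hBe₀, map_smul, Ω₀_smul_left] at e2
    rw [hAe₀, map_neg, map_smul, Ω₀_neg_left, Ω₀_smul_left] at e4
    rw [hAe₀] at e1 e2 e3
    linear_combination e2 - s * e1 + e3 - e4
  exact he₀ (hAell.eq_zero_of_apply_eq_smul (r := 0) (by rw [hzero, zero_smul]))

/-- On this plane B = sA, so one rescaled symplectic basis brings both maps to rotation form, with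
frequency om and rotation rate s·om. Closure of the circle makes that rate an integer. -/
theorem span_plane_invariant_type (hL : IsCircleAction L B) (hAB : ∀ u, A (B u) = B (A u))
    {α s : ℝ} {e : W4} (hα : α ≠ 0) (hAe : A (A e) = -(α ^ 2 • e)) (hBe : B e = s • A e)
    (hne : Ω₀ e (A e) ≠ 0) :
    ∃ (om : ℝ) (n : ℤ), HasFrequency A (Submodule.span ℝ {e, A e}) om ∧
      HasType L (Submodule.span ℝ {e, A e}) n := by
  -- The sign of om is the Krein sign: Ω₀(e', f') = -(c²/om) Ω₀(e, Ae) can be normalized to 1 with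
  -- real c only if -om / Ω₀(e, Ae) is positive.
  obtain ⟨om, hom, hsign⟩ : ∃ om : ℝ, om ^ 2 = α ^ 2 ∧ 0 < -om / Ω₀ e (A e) := by
    rcases lt_or_gt_of_ne (div_ne_zero hα hne) with h | h
    · exact ⟨α, rfl, by rw [neg_div]; linarith⟩
    · exact ⟨-α, by ring, by rwa [neg_neg]⟩
  have hom0 : om ≠ 0 := by rintro rfl; simp at hsign
  set c := Real.sqrt (-om / Ω₀ e (A e)) with hc
  have hc0 : 0 < c := Real.sqrt_pos.mpr hsign
  have hcsq : c ^ 2 * Ω₀ e (A e) = -om := by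
    rw [hc, Real.sq_sqrt hsign.le, div_mul_cancel₀ _ hne]
  set e' := c • e with he'
  set f' := (-(c / om)) • A e with hf'
  have hspan : Submodule.span ℝ {e', f'} = Submodule.span ℝ {e, A e} := by
    apply le_antisymm
    · rw [Submodule.span_le]
      rintro x (rfl | rfl)
      · exact Submodule.smul_mem _ _ (Submodule.subset_span (by simp))
      · exact Submodule.smul_mem _ _ (Submodule.subset_span (by simp))
    · rw [Submodule.span_le]
      rintro x (rfl | rfl)
      · have : x = c⁻¹ • e' := by rw [he', smul_smul, inv_mul_cancel₀ hc0.ne', one_smul]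
        rw [this]
        exact Submodule.smul_mem _ _ (Submodule.subset_span (by simp))
      · have : A e = (-(c / om))⁻¹ • f' := by
          rw [hf', smul_smul, inv_mul_cancel₀ (neg_ne_zero.mpr (div_ne_zero hc0.ne' hom0)),
            one_smul]
        rw [this]
        exact Submodule.smul_mem _ _ (Submodule.subset_span (by simp))
  have hΩ : Ω₀ e' f' = 1 := by
    rw [he', hf', Ω₀_smul_left, Ω₀_smul_right]
    field_simp
    linarith
  have hAe' : A e' = -(om • f') := by
    rw [he', hf', map_smul, smul_smul, ← neg_smul]
    congr 1
    field_simp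
  have hAf' : A f' = om • e' := by
    rw [he', hf', map_smul, hAe, smul_neg, ← neg_smul, smul_smul, smul_smul, ← hom]
    congr 1
    field_simp
  have hBe' : B e' = s • A e' := by rw [he', map_smul, map_smul, hBe, smul_comm]
  have hBf' : B f' = s • A f' := by
    rw [hf', map_smul, map_smul, ← hAB, hBe, map_smul, smul_comm]
  clear_value e' f'
  have hrot (t : ℝ) : L t e' = Real.cos (s * om * t) • e' - Real.sin (s * om * t) • f' := by
    have := hL.jordan_solution hAB hom0 (u := 0) (v := e') (b := 0) (s := s) (by simp)
      (by rw [hAe', map_neg, map_smul, hAf', smul_smul, pow_two]) (by simp)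
      (by simpa using hBe') t
    rw [this]
    simp only [smul_zero, add_zero, zero_mul, Real.exp_zero, one_smul, hAe', smul_neg, smul_smul,
      div_mul_cancel₀ _ hom0, sub_eq_add_neg]
  have hrot' (t : ℝ) : L t f' = Real.sin (s * om * t) • e' + Real.cos (s * om * t) • f' := by
    have := hL.jordan_solution hAB hom0 (u := 0) (v := f') (b := 0) (s := s) (by simp)
      (by rw [hAf', map_smul, hAe', smul_neg, smul_smul, pow_two]) (by simp)
      (by simpa using hBf') t
    rw [this, add_comm (_ • e')]
    simp only [smul_zero, add_zero, zero_mul, Real.exp_zero, one_smul, hAf', smul_smul,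
      div_mul_cancel₀ _ hom0]
  -- Pairing the identity L(2π)e' = e' with f' leaves cos(2π s om) = 1.
  obtain ⟨n, hn⟩ : ∃ n : ℤ, (n : ℝ) = s * om := by
    have h1 := hrot (2 * Real.pi)
    rw [hL.coe_two_pi] at h1
    have h2 : Ω₀ e' f' = Ω₀ (Real.cos (s * om * (2 * Real.pi)) • e' -
      Real.sin (s * om * (2 * Real.pi)) • f') f' := by rw [← h1]
    rw [Ω₀_sub_left, Ω₀_smul_left, Ω₀_smul_left, Ω₀_self, hΩ, mul_zero, sub_zero, mul_one] at h2
    obtain ⟨n, hn⟩ := (Real.cos_eq_one_iff _).mp h2.symm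
    exact ⟨n, mul_right_cancel₀ (by simp [Real.pi_ne_zero]) hn⟩
  refine ⟨om, n, ⟨e', f', ⟨hspan, hΩ⟩, hAe', hAf'⟩, e', f', ⟨hspan, hΩ⟩, fun φ => ?_⟩
  induction φ using Real.Angle.induction_on with
  | h t =>
    have hnt : n • (t : Real.Angle) = ((s * om * t : ℝ) : Real.Angle) := by
      rw [← hn, Real.Angle.intCast_mul_eq_zsmul]
    rw [hnt, Real.Angle.cos_coe, Real.Angle.sin_coe]
    exact ⟨hrot t, hrot' t⟩

/-- A semisimple elliptic infinitesimally symplectic map and a symplectic circle action that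
commute have a common normal form. -/
theorem exists_normal_form (hL : IsCircleAction L B) (hAell : IsEllipticMap A)
    (hss : Module.End.IsSemisimple (A : Module.End ℝ W4)) (hAB : ∀ u, A (B u) = B (A u))
    (hskew : ∀ u v, Ω₀ (A u) v = -Ω₀ u (A v)) :
    ∃ (om : Fin 2 → ℝ) (n : Fin 2 → ℤ) (P : Fin 2 → Submodule ℝ W4), IsCompl (P 0) (P 1) ∧
      (∀ u ∈ P 0, ∀ v ∈ P 1, Ω₀ u v = 0) ∧
      ∀ j, HasFrequency A (P j) (om j) ∧ HasType L (P j) (n j) := by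
  obtain ⟨α, s, e, hα, hAe, hBe, hne⟩ := exists_nondegenerate_vector hL hAell hss hAB hskew
  obtain ⟨om₀, n₀, hom₀, hn₀⟩ := span_plane_invariant_type hL hAB hα hAe hBe hne
  set P₀ := Submodule.span ℝ {e, A e} with hP₀
  -- The second plane is the symplectic complement of the first; it is invariant under A and B by
  -- skewness.
  let P₁ : Submodule ℝ W4 := LinearMap.ker (ΩB.flip e) ⊓ LinearMap.ker (ΩB.flip (A e))
  have hP₁ {u : W4} : u ∈ P₁ ↔ Ω₀ u e = 0 ∧ Ω₀ u (A e) = 0 := by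
    simp [P₁, ΩB]
  have horth : ∀ u ∈ P₀, ∀ v ∈ P₁, Ω₀ u v = 0 := by
    intro u hu v hv
    rw [hP₁] at hv
    obtain ⟨a, b, rfl⟩ := Submodule.mem_span_pair.mp hu
    rw [Ω₀_swap, Ω₀_add_right, Ω₀_smul_right, Ω₀_smul_right, hv.1, hv.2]
    ring
  have hsup : ∀ w : W4, ∃ u ∈ P₀, ∃ v ∈ P₁, u + v = w := by
    intro w
    set u : W4 := (Ω₀ w (A e) / Ω₀ e (A e)) • e + (-(Ω₀ w e / Ω₀ e (A e))) • A e with hu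
    refine ⟨u, Submodule.mem_span_pair.mpr ⟨_, _, rfl⟩, w - u, ?_, by abel⟩
    rw [hP₁, hu]
    simp only [Ω₀_sub_left, Ω₀_add_left, Ω₀_smul_left, Ω₀_self, Ω₀_swap (A e) e]
    constructor <;> field_simp <;> ring
  have hcompl : IsCompl P₀ P₁ := by
    constructor
    · rw [Submodule.disjoint_def]
      intro u hu hu'
      refine Ω₀_nondegenerate fun w => ?_
      obtain ⟨a, ha, b, hb, rfl⟩ := hsup w
      rw [Ω₀_add_right, horth u hu b hb, Ω₀_swap, horth a ha u hu']
      ring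
    · rw [codisjoint_iff, Submodule.eq_top_iff']
      intro w
      obtain ⟨a, ha, b, hb, rfl⟩ := hsup w
      exact Submodule.add_mem_sup ha hb
  have hAP₁ : ∀ u ∈ P₁, A u ∈ P₁ := by
    intro u hu
    rw [hP₁] at hu ⊢
    rw [hskew, hskew, hAe, Ω₀_neg_right, Ω₀_smul_right, hu.1, hu.2]
    simp
  have hBP₁ : ∀ u ∈ P₁, B u ∈ P₁ := by
    intro u hu
    rw [hP₁] at hu ⊢
    rw [hL.skew, hL.skew, ← hAB, hBe, map_smul, hAe, Ω₀_smul_right, Ω₀_smul_right, Ω₀_neg_right,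
      Ω₀_smul_right, hu.1, hu.2]
    simp
  have hfin (v : W4) (hv : v ≠ 0) : Module.finrank ℝ (Submodule.span ℝ {v, A v}) = 2 := by
    have hli : LinearIndependent ℝ ![v, A v] := by
      rw [LinearIndependent.pair_iff' hv]
      intro a ha
      exact hv (hAell.eq_zero_of_apply_eq_smul ha.symm)
    have := finrank_span_eq_card hli
    rwa [Matrix.range_cons_cons_empty, Fintype.card_fin] at this
  have he0 : e ≠ 0 := by rintro rfl; exact hne (Ω₀_zero_left _)
  have hdim : Module.finrank ℝ P₁ = 2 := by
    have h1 := Submodule.finrank_add_eq_of_isCompl hcompl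
    rw [hP₀, hfin e he0] at h1
    simp at h1
    omega
  obtain ⟨e₁, he₁, he₁0⟩ : ∃ e₁ ∈ P₁, e₁ ≠ 0 := by
    apply Submodule.exists_mem_ne_zero_of_ne_bot
    intro h
    rw [h] at hdim
    simp at hdim
  have hspan : Submodule.span ℝ {e₁, A e₁} = P₁ := by
    apply Submodule.eq_of_le_of_finrank_eq
    · rw [Submodule.span_le]
      rintro x (rfl | rfl)
      · exact he₁
      · exact hAP₁ _ he₁
    · rw [hdim, hfin e₁ he₁0]
  have hne₁ : Ω₀ e₁ (A e₁) ≠ 0 := by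
    intro h0
    refine he₁0 (Ω₀_nondegenerate fun w => ?_)
    obtain ⟨a, ha, b, hb, rfl⟩ := hsup w
    rw [← hspan] at hb
    obtain ⟨x, y, rfl⟩ := Submodule.mem_span_pair.mp hb
    rw [Ω₀_add_right, Ω₀_swap, horth a ha e₁ he₁, Ω₀_add_right, Ω₀_smul_right, Ω₀_smul_right, h0,
      Ω₀_self]
    ring
  obtain ⟨c, d, hcd⟩ := Submodule.mem_span_pair.mp (hspan ▸ hAP₁ _ (hAP₁ _ he₁))
  obtain ⟨c', s₁, hcs⟩ := Submodule.mem_span_pair.mp (hspan ▸ hBP₁ _ he₁)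
  -- Skewness gives Ω₀(A²e₁, e₁) = -Ω₀(Ae₁, Ae₁) = 0, which removes the Ae₁ component of A²e₁.
  have hd : d = 0 := by
    have h1 : Ω₀ (A (A e₁)) e₁ = 0 := by rw [hskew, Ω₀_self, neg_zero]
    rw [← hcd, Ω₀_add_left, Ω₀_smul_left, Ω₀_smul_left, Ω₀_self, Ω₀_swap] at h1
    simpa [hne₁] using h1
  -- Since A and B commute and are skew, Ω₀(Be₁, Ae₁) = Ω₀(Ae₁, Be₁), so this number is its own
  -- negative.
  have hc' : c' = 0 := by
    have h1 : Ω₀ (B e₁) (A e₁) = 0 := by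
      have h2 := hL.skew e₁ (A e₁)
      have h3 := hskew e₁ (B e₁)
      rw [← hAB] at h2
      have h4 := Ω₀_swap (A e₁) (B e₁)
      linarith
    rw [← hcs, Ω₀_add_left, Ω₀_smul_left, Ω₀_smul_left, Ω₀_self] at h1
    simpa [hne₁] using h1
  rw [hd, zero_smul, add_zero] at hcd
  rw [hc', zero_smul, zero_add] at hcs
  -- If c ≥ 0, the factorization (A - √c)(A + √c)e₁ = 0 yields a real eigenvector, which ellipticity
  -- forbids.
  have hcneg : c < 0 := by
    by_contra! hc
    have h1 : A (A e₁ + Real.sqrt c • e₁) = Real.sqrt c • (A e₁ + Real.sqrt c • e₁) := by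
      rw [map_add, map_smul, ← hcd, smul_add, smul_smul, Real.mul_self_sqrt hc, add_comm]
    have h2 := hAell.eq_zero_of_apply_eq_smul h1
    have h3 : A e₁ = (-Real.sqrt c) • e₁ := by
      rw [neg_smul]; exact eq_neg_of_add_eq_zero_left h2
    exact he₁0 (hAell.eq_zero_of_apply_eq_smul h3)
  obtain ⟨om₁, n₁, hom₁, hn₁⟩ := span_plane_invariant_type hL hAB (α := Real.sqrt (-c)) (s := s₁)
    (e := e₁) (Real.sqrt_ne_zero'.mpr (by linarith))
    (by rw [Real.sq_sqrt (by linarith), ← hcd, neg_smul, neg_neg]) hcs.symm hne₁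
  rw [hspan] at hom₁ hn₁
  refine ⟨![om₀, om₁], ![n₀, n₁], ![P₀, P₁], hcompl, horth, fun j => ?_⟩
  fin_cases j
  · exact ⟨hom₀, hn₀⟩
  · exact ⟨hom₁, hn₁⟩

end Planes

/-! ### Simultaneous diagonalization and definiteness of the quadratic form -/

section Definiteness

variable {A B : W4 →L[ℝ] W4} {L : Real.Angle → W4 →L[ℝ] W4} {P : Submodule ℝ W4} {om : ℝ} {n : ℤ}

theorem HasFrequency.apply_mem (h : HasFrequency A P om) {u : W4} (hu : u ∈ P) : A u ∈ P := by
  obtain ⟨e, f, ⟨rfl, -⟩, hAe, hAf⟩ := h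
  obtain ⟨a, b, rfl⟩ := Submodule.mem_span_pair.mp hu
  rw [map_add, map_smul, map_smul, hAe, hAf]
  exact Submodule.mem_span_pair.mpr ⟨b * om, -(a * om), by module⟩

/-- The infinitesimal generator of a circle action of type `n`. -/
theorem HasType.generator_apply (hL : IsCircleAction L B) (h : HasType L P n) :
    ∃ e f : W4, IsSymplecticPlaneBasis P e f ∧ B e = -((n : ℝ) • f) ∧ B f = (n : ℝ) • e := by
  obtain ⟨e, f, hef, hrot⟩ := h
  have hcoe (t : ℝ) : n • (t : Real.Angle) = ((n * t : ℝ) : Real.Angle) := by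
    rw [Real.Angle.intCast_mul_eq_zsmul]
  have hlin : HasDerivAt (fun t : ℝ => (n : ℝ) * t) n 0 := by
    simpa using (hasDerivAt_id (0 : ℝ)).const_mul (n : ℝ)
  have hc := hlin.cos
  have hs := hlin.sin
  simp only [mul_zero, Real.sin_zero, Real.cos_zero, neg_zero, zero_mul, one_mul] at hc hs
  refine ⟨e, f, hef, ?_, ?_⟩
  · have h1 := (hc.smul_const e).sub (hs.smul_const f)
    refine (hL.hasDerivAt e).unique ((h1.congr_deriv (by simp)).congr_of_eventuallyEq ?_)
    refine Filter.Eventually.of_forall fun t => ?_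
    simp only [(hrot t).1, hcoe, Real.Angle.cos_coe, Real.Angle.sin_coe, Pi.sub_apply]
  · have h1 := (hs.smul_const e).add (hc.smul_const f)
    refine (hL.hasDerivAt f).unique ((h1.congr_deriv (by simp)).congr_of_eventuallyEq ?_)
    refine Filter.Eventually.of_forall fun t => ?_
    simp only [(hrot t).2, hcoe, Real.Angle.cos_coe, Real.Angle.sin_coe, Pi.add_apply]

theorem HasType.generator_mem (hL : IsCircleAction L B) (h : HasType L P n) {u : W4}
    (hu : u ∈ P) : B u ∈ P := by
  obtain ⟨e, f, ⟨rfl, -⟩, hAe, hAf⟩ := h.generator_apply hL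
  obtain ⟨a, b, rfl⟩ := Submodule.mem_span_pair.mp hu
  rw [map_add, map_smul, map_smul, hAe, hAf]
  exact Submodule.mem_span_pair.mpr ⟨b * n, -(a * n), by module⟩

/-- The quadratic forms of the Hamiltonian and of the momentum are simultaneously diagonal on a
plane with a frequency and a type. -/
theorem exists_diagonal_basis (hL : IsCircleAction L B) (hAB : ∀ u, A (B u) = B (A u))
    (hskew : ∀ u v, Ω₀ (A u) v = -Ω₀ u (A v)) (hom : om ≠ 0) (hP : HasFrequency A P om)
    (hn : HasType L P n) :
    ∃ e f : W4, IsSymplecticPlaneBasis P e f ∧ ∀ a b : ℝ,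
      Ω₀ (A (a • e + b • f)) (a • e + b • f) = om * (a ^ 2 + b ^ 2) ∧
      Ω₀ (B (a • e + b • f)) (a • e + b • f) = n * (a ^ 2 + b ^ 2) := by
  obtain ⟨e', f', ⟨hspan', hef'⟩, hBe', hBf'⟩ := hn.generator_apply hL
  have hBmem {u : W4} (hu : u ∈ P) : B u ∈ P := hn.generator_mem hL hu
  obtain ⟨e, f, ⟨hspan, hef⟩, hAe, hAf⟩ := hP
  have heP : e ∈ P := hspan ▸ Submodule.subset_span (by simp)
  have hfe : Ω₀ f e = -1 := by rw [Ω₀_swap, hef]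
  obtain ⟨x, y, hBe⟩ := Submodule.mem_span_pair.mp (hspan ▸ hBmem heP)
  have hx : x = 0 := by
    have h1 : Ω₀ (B e) (A e) = 0 := by
      have h2 := hL.skew e (A e)
      have h3 := hskew e (B e)
      rw [← hAB] at h2
      have h4 := Ω₀_swap (A e) (B e)
      linarith
    rw [← hBe, hAe, Ω₀_neg_right, Ω₀_add_left, Ω₀_smul_right, Ω₀_smul_left, Ω₀_smul_left,
      Ω₀_smul_right,
      Ω₀_self, hef] at h1
    simpa [hom] using h1
  rw [hx, zero_smul, zero_add] at hBe
  have hBf : B f = -(y • e) := by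
    have h1 : A (B e) = B (A e) := hAB e
    rw [← hBe, hAe, map_smul, hAf, map_neg, map_smul] at h1
    apply smul_right_injective W4 hom
    simp only [smul_neg]
    rw [← neg_eq_iff_eq_neg.mpr h1, smul_comm]
  -- The bases realizing the frequency and the type may differ. Comparing B² gives only n² = y²; the
  -- value Ω₀(Be', e') fixes the sign, since n = -y(a² + b²) and a² + b² ≥ 0.
  have hy : (n : ℝ) = -y := by
    have he'P : e' ∈ P := hspan' ▸ Submodule.subset_span (by simp)
    obtain ⟨a, b, hab⟩ := Submodule.mem_span_pair.mp (hspan ▸ he'P)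
    have h1 : Ω₀ (B e') e' = n := by
      rw [hBe', Ω₀_neg_left, Ω₀_smul_left, Ω₀_swap, hef']; ring
    have h2 : Ω₀ (B e') e' = -y * (a ^ 2 + b ^ 2) := by
      rw [← hab, map_add, map_smul, map_smul, ← hBe, hBf]
      simp only [Ω₀_add_left, Ω₀_add_right, Ω₀_smul_left, Ω₀_smul_right, Ω₀_neg_left, Ω₀_self, hef,
        hfe]
      ring
    have h3 : Ω₀ (B (B e')) f' = -(n : ℝ) ^ 2 := by
      rw [hBe', map_neg, map_smul, hBf', Ω₀_neg_left, Ω₀_smul_left, Ω₀_smul_left, hef']; ring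
    have h4 : Ω₀ (B (B e')) f' = -y ^ 2 := by
      have : B (B e') = (-y ^ 2) • e' := by
        rw [← hab]
        simp only [map_add, map_smul, ← hBe, hBf, smul_neg, map_neg]
        module
      rw [this, Ω₀_smul_left, hef', mul_one]
    rw [h1] at h2
    rcases eq_or_ne y 0 with rfl | hy0
    · simpa using h2
    · have h5 : (a ^ 2 + b ^ 2) ^ 2 = 1 := by
        have : y ^ 2 * (a ^ 2 + b ^ 2) ^ 2 = y ^ 2 * 1 := by
          rw [h3, h2] at h4; linear_combination -h4
        exact mul_left_cancel₀ (pow_ne_zero 2 hy0) this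
      have h6 : a ^ 2 + b ^ 2 = 1 := by
        have : 0 ≤ a ^ 2 + b ^ 2 := by positivity
        nlinarith
      rw [h2, h6, mul_one]
  refine ⟨e, f, ⟨hspan, hef⟩, fun a b => ⟨?_, ?_⟩⟩
  · rw [map_add, map_smul, map_smul, hAe, hAf]
    simp only [Ω₀_add_left, Ω₀_add_right, Ω₀_smul_left, Ω₀_smul_right, Ω₀_neg_left, Ω₀_self, hef,
        hfe]
    ring
  · rw [map_add, map_smul, map_smul, ← hBe, hBf, hy]
    simp only [Ω₀_add_left, Ω₀_add_right, Ω₀_smul_left, Ω₀_smul_right, Ω₀_neg_left, Ω₀_self, hef,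
        hfe]
    ring

/-- Invariance and mutual orthogonality of the planes kill the cross terms, so the form is a sum of
two multiples of squared lengths. The product condition covers the positive and the negative
definite case together. -/
theorem quadratic_form_definite_iff (hL : IsCircleAction L B) (hAB : ∀ u, A (B u) = B (A u))
    (hskew : ∀ u v, Ω₀ (A u) v = -Ω₀ u (A v)) {om : Fin 2 → ℝ} {n : Fin 2 → ℤ}
    {P : Fin 2 → Submodule ℝ W4} (hom : ∀ j, om j ≠ 0) (hcompl : IsCompl (P 0) (P 1))
    (horth : ∀ u ∈ P 0, ∀ v ∈ P 1, Ω₀ u v = 0)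
    (hP : ∀ j, HasFrequency A (P j) (om j) ∧ HasType L (P j) (n j)) (c : ℝ) :
    IsDefinite (fun u v => Ω₀ (A u) v + c * Ω₀ (B u) v) ↔
      0 < (om 0 + c * n 0) * (om 1 + c * n 1) := by
  obtain ⟨e₀, f₀, ⟨hs₀, hef₀⟩, hq₀⟩ :=
    exists_diagonal_basis hL hAB hskew (hom 0) (hP 0).1 (hP 0).2
  obtain ⟨e₁, f₁, ⟨hs₁, hef₁⟩, hq₁⟩ :=
    exists_diagonal_basis hL hAB hskew (hom 1) (hP 1).1 (hP 1).2
  set Q : W4 → ℝ := fun u => Ω₀ (A u) u + c * Ω₀ (B u) u with hQ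
  have key (a b a' b' : ℝ) : Q ((a • e₀ + b • f₀) + (a' • e₁ + b' • f₁)) =
      (om 0 + c * n 0) * (a ^ 2 + b ^ 2) + (om 1 + c * n 1) * (a' ^ 2 + b' ^ 2) := by
    have hu : a • e₀ + b • f₀ ∈ P 0 := hs₀ ▸ Submodule.mem_span_pair.mpr ⟨a, b, rfl⟩
    have hv : a' • e₁ + b' • f₁ ∈ P 1 := hs₁ ▸ Submodule.mem_span_pair.mpr ⟨a', b', rfl⟩
    obtain ⟨h1, h2⟩ := hq₀ a b
    obtain ⟨h3, h4⟩ := hq₁ a' b'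
    generalize a • e₀ + b • f₀ = u at *
    generalize a' • e₁ + b' • f₁ = v at *
    have k1 := horth _ ((hP 0).1.apply_mem hu) _ hv
    have k2 := horth _ ((hP 0).2.generator_mem hL hu) _ hv
    have k3 := horth _ hu _ ((hP 1).1.apply_mem hv)
    have k4 := horth _ hu _ ((hP 1).2.generator_mem hL hv)
    rw [Ω₀_swap] at k3 k4
    simp only [hQ, map_add, Ω₀_add_left, Ω₀_add_right]
    linear_combination h1 + c * h2 + h3 + c * h4 + k1 + c * k2 - k3 - c * k4
  have hdecomp (u : W4) : ∃ a b a' b' : ℝ, u = (a • e₀ + b • f₀) + (a' • e₁ + b' • f₁) := by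
    have : u ∈ P 0 ⊔ P 1 := hcompl.sup_eq_top ▸ Submodule.mem_top
    obtain ⟨x, hx, y, hy, rfl⟩ := Submodule.mem_sup.mp this
    rw [← hs₀] at hx
    rw [← hs₁] at hy
    obtain ⟨a, b, rfl⟩ := Submodule.mem_span_pair.mp hx
    obtain ⟨a', b', rfl⟩ := Submodule.mem_span_pair.mp hy
    exact ⟨a, b, a', b', rfl⟩
  have hpos {a b a' b' : ℝ} (h : (a • e₀ + b • f₀) + (a' • e₁ + b' • f₁) ≠ 0) :
      0 < (a ^ 2 + b ^ 2) + (a' ^ 2 + b' ^ 2) := by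
    by_contra! hle
    have h1 : a = 0 := by nlinarith [sq_nonneg a, sq_nonneg b, sq_nonneg a', sq_nonneg b']
    have h2 : b = 0 := by nlinarith [sq_nonneg a, sq_nonneg b, sq_nonneg a', sq_nonneg b']
    have h3 : a' = 0 := by nlinarith [sq_nonneg a, sq_nonneg b, sq_nonneg a', sq_nonneg b']
    have h4 : b' = 0 := by nlinarith [sq_nonneg a, sq_nonneg b, sq_nonneg a', sq_nonneg b']
    simp [h1, h2, h3, h4] at h
  have he₀ : e₀ ≠ 0 := by rintro rfl; rw [Ω₀_zero_left] at hef₀; exact zero_ne_one hef₀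
  have he₁ : e₁ ≠ 0 := by rintro rfl; rw [Ω₀_zero_left] at hef₁; exact zero_ne_one hef₁
  have hQ₀ : Q e₀ = om 0 + c * n 0 := by simpa using key 1 0 0 0
  have hQ₁ : Q e₁ = om 1 + c * n 1 := by simpa using key 0 0 1 0
  constructor
  · rintro (h | h)
    · have h0 := h e₀ he₀
      have h1 := h e₁ he₁
      change 0 < Q _ at h0 h1
      rw [hQ₀] at h0
      rw [hQ₁] at h1
      exact mul_pos h0 h1
    · have h0 := h e₀ he₀
      have h1 := h e₁ he₁
      change Q _ < 0 at h0 h1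
      rw [hQ₀] at h0
      rw [hQ₁] at h1
      exact mul_pos_of_neg_of_neg h0 h1
  · intro h
    rcases mul_pos_iff.mp h with ⟨h0, h1⟩ | ⟨h0, h1⟩
    · left
      intro u hu
      change 0 < Q u
      obtain ⟨a, b, a', b', rfl⟩ := hdecomp u
      have hp := hpos hu
      rw [key]
      have p1 : 0 ≤ a ^ 2 + b ^ 2 := by positivity
      have p2 : 0 ≤ a' ^ 2 + b' ^ 2 := by positivity
      rcases p1.eq_or_lt with p | p
      · rw [← p] at hp ⊢
        rw [mul_zero]
        rw [zero_add] at hp ⊢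
        exact mul_pos h1 hp
      · exact add_pos_of_pos_of_nonneg (mul_pos h0 p) (mul_nonneg h1.le p2)
    · right
      intro u hu
      change Q u < 0
      obtain ⟨a, b, a', b', rfl⟩ := hdecomp u
      have hp := hpos hu
      rw [key]
      have p1 : 0 ≤ a ^ 2 + b ^ 2 := by positivity
      have p2 : 0 ≤ a' ^ 2 + b' ^ 2 := by positivity
      rcases p1.eq_or_lt with p | p
      · rw [← p] at hp ⊢
        rw [mul_zero]
        rw [zero_add] at hp ⊢
        exact mul_neg_of_neg_of_pos h1 hp
      · exact add_neg_of_neg_of_nonpos (mul_neg_of_neg_of_pos h0 p)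
          (mul_nonpos_of_nonpos_of_nonneg h1.le p2)

/-- A line in the plane through a point of the open second or fourth quadrant meets the open first
or third quadrant if and only if it misses the origin. -/
theorem exists_mul_pos_iff {a b p q : ℝ} (hab : a * b < 0) :
    (∃ c : ℝ, 0 < (a + c * p) * (b + c * q)) ↔ a * q - b * p ≠ 0 := by
  have ha : a ≠ 0 := by rintro rfl; simp at hab
  have hb : b ≠ 0 := by rintro rfl; simp at hab
  constructor
  -- At resonance a(b + cq) = b(a + cp), so the product has the sign of ab or vanishes.
  · rintro ⟨c, hc⟩ h
    have h1 : a ^ 2 * ((a + c * p) * (b + c * q)) = a * b * (a + c * p) ^ 2 := by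
      linear_combination (a * c * (a + c * p)) * h
    have h2 : 0 < a ^ 2 * ((a + c * p) * (b + c * q)) := by positivity
    have h3 : a * b * (a + c * p) ^ 2 ≤ 0 :=
      mul_nonpos_of_nonpos_of_nonneg hab.le (sq_nonneg _)
    linarith
  · intro h
    rcases eq_or_ne p 0 with rfl | hp
    · have hq : q ≠ 0 := by rintro rfl; simp at h
      -- This choice turns the second factor into a, so the product is a²; the next case gives b² in
      -- the same way.
      refine ⟨(a - b) / q, ?_⟩
      rw [div_mul_cancel₀ _ hq]
      ring_nf
      positivity
    rcases eq_or_ne q 0 with rfl | hq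
    · refine ⟨(b - a) / p, ?_⟩
      rw [div_mul_cancel₀ _ hp]
      ring_nf
      positivity
    rcases lt_or_gt_of_ne (mul_ne_zero hp hq) with hpq | hpq
    · refine ⟨-(a * q + b * p) / (2 * (p * q)), ?_⟩
      have : (a + -(a * q + b * p) / (2 * (p * q)) * p) * (b + -(a * q + b * p) / (2 * (p * q)) * q)
          = (a * q - b * p) ^ 2 / (4 * -(p * q)) := by
        field_simp
        ring
      rw [this]
      have : 0 < -(p * q) := by linarith
      positivity
    · refine ⟨(a * q - 3 * b * p) / (2 * (p * q)), ?_⟩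
      have : (a + (a * q - 3 * b * p) / (2 * (p * q)) * p) *
          (b + (a * q - 3 * b * p) / (2 * (p * q)) * q)
          = 3 * (a * q - b * p) ^ 2 / (4 * (p * q)) := by
        field_simp
        ring
      rw [this]
      positivity

end Definiteness

/-! ### Second derivatives at critical points -/

section Calculus

variable {V E : Type*} [NormedAddCommGroup V] [NormedSpace ℝ V] [NormedAddCommGroup E]
  [NormedSpace ℝ E]

/-- The second-order chain rule. Its last term disappears at a critical point of g, and then only
the first derivative of f matters. -/
theorem fderiv_fderiv_comp {g : E → ℝ} {f : V → E} {v₀ : V} (hg : ContDiffAt ℝ 2 g (f v₀))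
    (hf : ContDiffAt ℝ 2 f v₀) (u v : V) :
    fderiv ℝ (fderiv ℝ (g ∘ f)) v₀ u v =
      fderiv ℝ (fderiv ℝ g) (f v₀) (fderiv ℝ f v₀ u) (fderiv ℝ f v₀ v) +
        fderiv ℝ g (f v₀) (fderiv ℝ (fderiv ℝ f) v₀ u v) := by
  have h1 : fderiv ℝ (g ∘ f) =ᶠ[𝓝 v₀] fun w => (fderiv ℝ g (f w)).comp (fderiv ℝ f w) := by
    have e1 : ∀ᶠ w in 𝓝 v₀, ContDiffAt ℝ 2 f w := hf.eventually (by simp)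
    have e2 : ∀ᶠ w in 𝓝 v₀, ContDiffAt ℝ 2 g (f w) :=
      hf.continuousAt.eventually (hg.eventually (by simp))
    filter_upwards [e1, e2] with w hw hw'
    exact fderiv_comp w (hw'.differentiableAt (by simp)) (hw.differentiableAt (by simp))
  rw [h1.fderiv_eq]
  have hg' : HasFDerivAt (fderiv ℝ g) (fderiv ℝ (fderiv ℝ g) (f v₀)) (f v₀) :=
    ((hg.fderiv_right (m := 1) (by norm_num)).differentiableAt (by simp)).hasFDerivAt
  have hf' : HasFDerivAt (fderiv ℝ f) (fderiv ℝ (fderiv ℝ f) v₀) v₀ :=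
    ((hf.fderiv_right (m := 1) (by norm_num)).differentiableAt (by simp)).hasFDerivAt
  have hf0 : HasFDerivAt f (fderiv ℝ f v₀) v₀ := (hf.differentiableAt (by simp)).hasFDerivAt
  have h2 := (hg'.comp v₀ hf0).clm_comp hf'
  simp only [Function.comp_def] at h2
  rw [h2.fderiv]
  simp [add_comm]

theorem fderiv_fderiv_comp_clm {g : E → ℝ} (T : V →L[ℝ] E) {v₀ : V}
    (hg : ContDiffAt ℝ 2 g (T v₀)) (u v : V) :
    fderiv ℝ (fderiv ℝ (g ∘ T)) v₀ u v = fderiv ℝ (fderiv ℝ g) (T v₀) (T u) (T v) := by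
  rw [fderiv_fderiv_comp hg T.contDiff.contDiffAt]
  have : fderiv ℝ (T : V → E) = fun _ => T := by ext1 w; exact T.fderiv
  simp [this]

end Calculus

/-! ### Reading derivatives in the chart at a point -/

section Chart

variable {M : Type*} [TopologicalSpace M] [ChartedSpace E12 M]
variable {V : Type*} [NormedAddCommGroup V] [NormedSpace ℝ V]

/-- The derivative of a map into `M`, read in the model space to which every tangent space of `M` is
equal by definition. -/
def tderiv (f : V → M) (v : V) : V →L[ℝ] E12 := mfderiv 𝓘(ℝ, V) (𝓡 12) f v

/-- The chart is the preferred one at the base point, so no derivative of a change of charts enters.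
-/
theorem tderiv_eq_fderiv_extChartAt {x : M} {f : V → M} {v₀ : V} (hv : f v₀ = x)
    (hf : MDifferentiableAt 𝓘(ℝ, V) (𝓡 12) f v₀) :
    tderiv f v₀ = fderiv ℝ (extChartAt (𝓡 12) x ∘ f) v₀ := by
  subst hv
  rw [tderiv, hf.mfderiv]
  simp only [writtenInExtChartAt, extChartAt_model_space_eq_id, PartialEquiv.refl_coe,
    PartialEquiv.refl_symm, ModelWithCorners.range_eq_univ, fderivWithin_univ, Function.comp_id]
  rfl

variable [IsManifold (𝓡 12) ∞ M]

theorem contDiffAt_extChartAt_comp {x : M} {f : V → M} {v₀ : V}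
    (hv : f v₀ ∈ (chartAt E12 x).source) (hf : ContMDiffAt 𝓘(ℝ, V) (𝓡 12) ∞ f v₀) :
    ContDiffAt ℝ ∞ (extChartAt (𝓡 12) x ∘ f) v₀ := by
  rw [← contMDiffAt_iff_contDiffAt]
  exact (contMDiffAt_extChartAt' hv).comp v₀ hf

theorem fderiv_extChartAt_comp {x : M} {f : V → M} {v₀ : V}
    (hv : f v₀ ∈ (chartAt E12 x).source) (hf : MDifferentiableAt 𝓘(ℝ, V) (𝓡 12) f v₀) (u : V) :
    fderiv ℝ (extChartAt (𝓡 12) x ∘ f) v₀ u =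
      mfderiv (𝓡 12) 𝓘(ℝ, E12) (extChartAt (𝓡 12) x) (f v₀)
        (mfderiv 𝓘(ℝ, V) (𝓡 12) f v₀ u) := by
  rw [← mfderiv_eq_fderiv]
  exact mfderiv_comp_apply v₀ (mdifferentiableAt_extChartAt hv) hf u

/-- At a critical point, the second derivative of a function along a map depends only on the first
derivative of the map. -/
theorem fderiv_fderiv_comp_of_critical {x : M} {G : M → ℝ}
    (hG : ContMDiff (𝓡 12) 𝓘(ℝ, ℝ) ∞ G)
    (hcrit : ∀ v : TangentSpace (𝓡 12) x, mfderiv (𝓡 12) 𝓘(ℝ, ℝ) G x v = 0)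
    {f : V → M} {v₀ : V} (hv : f v₀ = x) (hf : ContMDiffAt 𝓘(ℝ, V) (𝓡 12) ∞ f v₀) (u v : V) :
    fderiv ℝ (fderiv ℝ (G ∘ f)) v₀ u v =
      fderiv ℝ (fderiv ℝ (G ∘ (extChartAt (𝓡 12) x).symm)) (extChartAt (𝓡 12) x x)
        (tderiv f v₀ u) (tderiv f v₀ v) := by
  have hsrc : f v₀ ∈ (chartAt E12 x).source := by rw [hv]; exact mem_chart_source E12 x
  have h1 : G ∘ f =ᶠ[𝓝 v₀]
      (G ∘ (extChartAt (𝓡 12) x).symm) ∘ (extChartAt (𝓡 12) x ∘ f) := by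
    have : ∀ᶠ w in 𝓝 v₀, f w ∈ (chartAt E12 x).source :=
      hf.continuousAt.eventually ((chartAt E12 x).open_source.mem_nhds hsrc)
    filter_upwards [this] with w hw
    have hw' : f w ∈ (extChartAt (𝓡 12) x).source := by rwa [extChartAt_source]
    simp only [Function.comp, (extChartAt (𝓡 12) x).left_inv hw']
  have hGd : ContDiffAt ℝ ∞ (G ∘ (extChartAt (𝓡 12) x).symm) (extChartAt (𝓡 12) x x) := by
    rw [← contMDiffAt_iff_contDiffAt]
    refine hG.contMDiffAt.comp _ ?_
    exact (contMDiffOn_extChartAt_symm x).contMDiffAt (extChartAt_target_mem_nhds x)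
  have hGc : fderiv ℝ (G ∘ (extChartAt (𝓡 12) x).symm) (extChartAt (𝓡 12) x x) = 0 := by
    have h2 := (hG.mdifferentiable (by simp) x).mfderiv
    simp only [writtenInExtChartAt, extChartAt_model_space_eq_id, PartialEquiv.refl_coe,
      ModelWithCorners.range_eq_univ, fderivWithin_univ, Function.id_comp] at h2
    rw [← h2]
    exact ContinuousLinearMap.ext hcrit
  rw [(h1.fderiv).fderiv_eq, fderiv_fderiv_comp (by
      simp only [Function.comp, hv]; exact hGd.of_le (by norm_cast))
    ((contDiffAt_extChartAt_comp hsrc hf).of_le (by norm_cast)),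
    tderiv_eq_fderiv_extChartAt hv (hf.mdifferentiableAt (by simp))]
  simp only [Function.comp, hv] at hGc ⊢
  rw [hGc, zero_apply, add_zero]

end Chart

/-! ### The action and the momentum map near an axisymmetric relative equilibrium -/

section Action

namespace EGroup

theorem ofReal_zero : ofReal 0 = 1 := by
  simp [ofReal, one_def]

theorem exists_ofReal_eq (g : EGroup) : ∃ ξ : LieAlg, ofReal ξ = g := by
  obtain ⟨⟨φ⟩, a, ⟨θ⟩⟩ := g
  exact ⟨(φ, a, θ), rfl⟩

theorem rotate_zero (a : R3) : rotate 0 a = a := by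
  ext i; fin_cases i <;> simp [rotate]

theorem rotate_neg_rotate (φ : Real.Angle) (a : R3) : rotate φ (rotate (-φ) a) = a := by
  ext i; fin_cases i <;> simp [rotate]
  · linear_combination (a 0) * φ.cos_sq_add_sin_sq
  · linear_combination (a 1) * φ.cos_sq_add_sin_sq

theorem ofReal_snd_add (k k' : R3 × ℝ) :
    ofReal (0, k + k') = ofReal (0, k) * ofReal (0, k') := by
  simp [ofReal, mul_def, rotate_zero]

theorem diag_add (φ ψ : Real.Angle) : diag (φ + ψ) = diag φ * diag ψ := by
  simp only [diag, mul_def]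
  congr 1
  ext i; fin_cases i <;> simp [rotate]

theorem Ad_ofReal_snd (k k' : R3 × ℝ) : Ad (ofReal (0, k)) (0, k') = (0, k') := by
  simp [ofReal, Ad, rotate_zero]

theorem Ad_diag_snd (φ : Real.Angle) (a : R3) (θ : ℝ) :
    Ad (diag φ) (0, a, θ) = (0, rotate φ a, θ) := by
  simp [diag, Ad]

theorem eq_of_pair_eq {μ ν : LieAlg} (h : ∀ (a : R3) (θ : ℝ), pair μ (0, a, θ) = pair ν (0, a, θ)) :
    μ.2 = ν.2 := by
  refine Prod.ext (ext_inner_right ℝ fun a => ?_) ?_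
  · simpa [pair] using h a 0
  · simpa [pair] using h 0 1

end EGroup

variable {M : Type*} [TopologicalSpace M] [ChartedSpace E12 M] [MulAction EGroup M]

/-- The vector `ξ x`, read in the model space. -/
def gen (ξ : LieAlg) (x : M) : E12 := generator ξ x

/-- The infinitesimal action of `ℝ³ × SO(2)_R` at `x`. -/
def kGenerator (x : M) : (R3 × ℝ) →L[ℝ] E12 :=
  (mfderiv 𝓘(ℝ, LieAlg) (𝓡 12) (fun η : LieAlg => ofReal η • x) 0 : LieAlg →L[ℝ] E12).comp
    (ContinuousLinearMap.inr ℝ ℝ (R3 × ℝ))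

theorem gen_snd (x : M) (k : R3 × ℝ) : gen (0, k) x = kGenerator x k := rfl

namespace HamSystem

theorem contMDiff_smul (S : HamSystem M) (g : EGroup) :
    ContMDiff (𝓡 12) (𝓡 12) ∞ (fun y : M => g • y) := by
  obtain ⟨ξ, rfl⟩ := exists_ofReal_eq g
  exact S.smooth_action.comp (contMDiff_const.prodMk contMDiff_id)

theorem contMDiffAt_ofReal_smul (S : HamSystem M) {V : Type*} [NormedAddCommGroup V]
    [NormedSpace ℝ V] {ξ : V → LieAlg} {f : V → M} {v : V} (hξ : ContDiffAt ℝ ∞ ξ v)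
    (hf : ContMDiffAt 𝓘(ℝ, V) (𝓡 12) ∞ f v) :
    ContMDiffAt 𝓘(ℝ, V) (𝓡 12) ∞ (fun w => ofReal (ξ w) • f w) v :=
  S.smooth_action.contMDiffAt.comp v (hξ.contMDiffAt.prodMk hf)

/-- The derivative of `v ↦ ofReal (ξ v) • f v` where `ξ v = 0`. -/
theorem tderiv_ofReal_smul (S : HamSystem M) [IsManifold (𝓡 12) ∞ M] {V : Type*}
    [NormedAddCommGroup V] [NormedSpace ℝ V] {ξ : V → LieAlg} {f : V → M} {v : V} {x : M}
    (hξ : ContDiffAt ℝ ∞ ξ v)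
    (hf : ContMDiffAt 𝓘(ℝ, V) (𝓡 12) ∞ f v) (h0 : ξ v = 0) (hx : f v = x) (u : V) :
    tderiv (fun w => ofReal (ξ w) • f w) v u = gen (fderiv ℝ ξ v u) x + tderiv f v u := by
  have hsm := S.contMDiffAt_ofReal_smul hξ hf
  have hval : ofReal (ξ v) • f v = x := by rw [h0, ofReal_zero, one_smul, hx]
  rw [tderiv_eq_fderiv_extChartAt (f := fun w => ofReal (ξ w) • f w) hval
      (hsm.mdifferentiableAt (by simp)),
    tderiv_eq_fderiv_extChartAt hx (hf.mdifferentiableAt (by simp))]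
  -- The action in the chart, with group element and parameter as independent variables; its
  -- derivative at (0, v) is additive in the two directions.
  let a : LieAlg × V → E12 := extChartAt (𝓡 12) x ∘ fun p : LieAlg × V => ofReal p.1 • f p.2
  have ha : ContDiffAt ℝ ∞ a (0, v) := by
    refine contDiffAt_extChartAt_comp ?_ ?_
    · simp only [ofReal_zero, one_smul, hx]
      exact mem_chart_source E12 x
    · have hf2 : ContMDiffAt 𝓘(ℝ, LieAlg × V) (𝓡 12) ∞ (f ∘ Prod.snd) ((0 : LieAlg), v) :=
        ContMDiffAt.comp (I' := 𝓘(ℝ, V)) ((0 : LieAlg), v) hf contDiffAt_snd.contMDiffAt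
      exact S.contMDiffAt_ofReal_smul contDiffAt_fst hf2
  have had : HasFDerivAt a (fderiv ℝ a (0, v)) (0, v) :=
    (ha.differentiableAt (by simp)).hasFDerivAt
  have h1 : fderiv ℝ (extChartAt (𝓡 12) x ∘ fun w => ofReal (ξ w) • f w) v u =
      fderiv ℝ a (0, v) (fderiv ℝ ξ v u, u) := by
    have hξ' : HasFDerivAt ξ (fderiv ℝ ξ v) v := (hξ.differentiableAt (by simp)).hasFDerivAt
    have h2 : HasFDerivAt (fun w => (ξ w, w)) _ v := hξ'.prodMk (hasFDerivAt_id v)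
    have h3 := HasFDerivAt.comp (g := a) (f := fun w => (ξ w, w)) v (by rw [h0]; exact had) h2
    have h4 := h3.fderiv
    change fderiv ℝ (extChartAt (𝓡 12) x ∘ fun w => ofReal (ξ w) • f w) v = _ at h4
    rw [h4]
    rfl
  have h2 : fderiv ℝ (extChartAt (𝓡 12) x ∘ f) v u = fderiv ℝ a (0, v) (0, u) := by
    have h3 := HasFDerivAt.comp (g := a) (f := fun w => ((0 : LieAlg), w)) v had
      (hasFDerivAt_prodMk_right (0 : LieAlg) v)
    have h4 := h3.fderiv
    have h5 : a ∘ (fun w => ((0 : LieAlg), w)) = extChartAt (𝓡 12) x ∘ f := by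
      funext w
      simp only [a, Function.comp, ofReal_zero, one_smul]
    rw [h5] at h4
    rw [h4]
    rfl
  have h3 (η : LieAlg) : gen η x = fderiv ℝ a (0, v) (η, 0) := by
    have hd : MDifferentiableAt 𝓘(ℝ, LieAlg) (𝓡 12) (fun η : LieAlg => ofReal η • x) 0 :=
      (S.contMDiffAt_ofReal_smul (ξ := id) contDiffAt_id contMDiffAt_const).mdifferentiableAt
        (by simp)
    have h3 := HasFDerivAt.comp (g := a) (f := fun η => (η, v)) (0 : LieAlg) had
      (hasFDerivAt_prodMk_left (0 : LieAlg) v)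
    have h4 := h3.fderiv
    have h5 : a ∘ (fun η => (η, v)) = extChartAt (𝓡 12) x ∘ fun η : LieAlg => ofReal η • x := by
      funext w
      simp only [a, Function.comp, hx]
    rw [h5, ← tderiv_eq_fderiv_extChartAt (f := fun η : LieAlg => ofReal η • x)
      (by rw [ofReal_zero, one_smul]) hd] at h4
    exact congrArg (fun D : LieAlg →L[ℝ] E12 => D η) h4
  rw [h1, h2, h3, ← map_add]
  simp

end HamSystem
end Action

/-! ### Pointwise symplectic form, momentum identity and local freeness of K -/

section ReducedSpace

variable {M : Type*} [TopologicalSpace M] [ChartedSpace E12 M] [MulAction EGroup M]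

theorem update_cons_one {α : Type*} (u v w : α) : Function.update ![u, v] 1 w = ![u, w] := by
  ext i; fin_cases i <;> rfl

/-- An alternating 2-form as a bilinear form. -/
def bilinOfAlternating (α : E12 [⋀^Fin 2]→L[ℝ] ℝ) : LinearMap.BilinForm ℝ E12 :=
  LinearMap.mk₂ ℝ (fun u v => α ![u, v])
    (fun u u' v => α.toContinuousMultilinearMap.toMultilinearMap.cons_add ![v] u u')
    (fun c u v => α.toContinuousMultilinearMap.toMultilinearMap.cons_smul ![v] c u)
    (fun u v v' => by simpa only [update_cons_one] using α.map_update_add ![u, v] 1 v v')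
    (fun c u v => by simpa only [update_cons_one] using α.map_update_smul ![u, v] 1 c v)

namespace HamSystem

/-- The symplectic form at `y`, as a bilinear form on the model space. -/
def form (S : HamSystem M) (y : M) : LinearMap.BilinForm ℝ E12 := bilinOfAlternating (S.Ω y)

theorem form_self (S : HamSystem M) (y : M) (u : E12) : S.form y u u = 0 :=
  (S.Ω y : E12 [⋀^Fin 2]→L[ℝ] ℝ).map_eq_zero_of_eq ![u, u] (i := 0) (j := 1) rfl (by simp)

theorem form_isAlt (S : HamSystem M) (y : M) : (S.form y).IsAlt := S.form_self y

theorem form_swap (S : HamSystem M) (y : M) (u v : E12) : S.form y u v = -S.form y v u := by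
  rw [← LinearMap.IsAlt.neg (S.form_isAlt y) v u]

theorem form_nondegenerate (S : HamSystem M) (y : M) : (S.form y).Nondegenerate := by
  refine (LinearMap.IsRefl.nondegenerate_iff_separatingLeft (S.form_isAlt y).isRefl).mpr ?_
  exact fun u hu => S.symplectic.nondegenerate y u hu

theorem pair_contMDiff (S : HamSystem M) (ξ : LieAlg) :
    ContMDiff (𝓡 12) 𝓘(ℝ, ℝ) ∞ (fun y => pair (S.J y) ξ) := by
  have h : ContDiff ℝ ∞ (fun μ : LieAlg => pair μ ξ) := by
    unfold pair
    exact ((contDiff_fst.mul contDiff_const).add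
      ((contDiff_snd.fst).inner ℝ contDiff_const)).add (contDiff_snd.snd.mul contDiff_const)
  exact h.contMDiff.comp S.J_smooth

theorem form_gen (S : HamSystem M) (y : M) (ξ : LieAlg) (v : E12) :
    S.form y (gen ξ y) v =
      (mfderiv (𝓡 12) 𝓘(ℝ, ℝ) (fun z => pair (S.J z) ξ) y : E12 →L[ℝ] ℝ) v :=
  S.J_momentum y ξ v

theorem form_gen_tderiv {V : Type*} [NormedAddCommGroup V] [NormedSpace ℝ V] (S : HamSystem M)
    {f : V → M} {v : V} (hf : MDifferentiableAt 𝓘(ℝ, V) (𝓡 12) f v) (ξ : LieAlg) (u : V) :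
    S.form (f v) (gen ξ (f v)) (tderiv f v u) =
      fderiv ℝ (fun w => pair (S.J (f w)) ξ) v u := by
  rw [form_gen, ← mfderiv_eq_fderiv]
  exact (mfderiv_comp_apply v ((S.pair_contMDiff ξ).mdifferentiable (by simp) (f v)) hf u).symm

variable {S : HamSystem M} {x : M}

theorem gen_eq_tderiv [IsManifold (𝓡 12) ∞ M] (S : HamSystem M) (ξ : LieAlg) (x : M) :
    gen ξ x = tderiv (fun t : ℝ => ofReal (t • ξ) • x) 0 1 := by
  have hξ : ContDiff ℝ ∞ (fun t : ℝ => t • ξ) := contDiff_id.smul contDiff_const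
  have h := S.tderiv_ofReal_smul (f := fun _ : ℝ => x) (x := x) hξ.contDiffAt contMDiffAt_const
    (zero_smul ℝ ξ) rfl 1
  have h2 : tderiv (fun _ : ℝ => x) 0 = 0 := mfderiv_const
  have h3 : fderiv ℝ (fun t : ℝ => t • ξ) 0 1 = ξ := by
    have : HasDerivAt (fun t : ℝ => t • ξ) ((1 : ℝ) • ξ) 0 := (hasDerivAt_id 0).smul_const ξ
    rw [fderiv_apply_one_eq_deriv, this.deriv, one_smul]
  rw [h, h2, h3, zero_apply, add_zero]

theorem gen_diag [IsManifold (𝓡 12) ∞ M] (hx : S.IsAxisymmetricRE x) : gen (1, 0, 1) x = 0 := by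
  rw [S.gen_eq_tderiv]
  have h : (fun t : ℝ => ofReal (t • ((1 : ℝ), (0 : R3), (1 : ℝ))) • x) = fun _ => x := by
    funext t
    rw [hx.isotropy]
    exact ⟨t, by simp [ofReal, diag]⟩
  rw [h]
  exact congrArg (fun D : ℝ →L[ℝ] E12 => D 1) mfderiv_const

/-- If k has zero velocity at x, the one-parameter subgroup property transports this to all times,
so the curve exp(tk)x is constant near t = 0. Then exp(tk) fixes x for some small t > 0 and is
diagonal with zero rotation angle, which forces k = 0. -/
theorem kGenerator_injective [IsManifold (𝓡 12) ∞ M] (hx : S.IsAxisymmetricRE x) :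
    Function.Injective (kGenerator x) := by
  rw [injective_iff_map_eq_zero]
  intro k hk
  rw [← gen_snd, S.gen_eq_tderiv] at hk
  set c : ℝ → M := fun t => ofReal (t • ((0 : ℝ), k)) • x with hc
  have hc' (t : ℝ) : c t = ofReal (0, t • k) • x := by simp [hc]
  have hcx : c 0 = x := by
    rw [hc', zero_smul]
    exact (congrArg (· • x) ofReal_zero).trans (one_smul _ x)
  have hcd : ContMDiff 𝓘(ℝ, ℝ) (𝓡 12) ∞ c := fun t =>
    S.contMDiffAt_ofReal_smul (contDiff_id.smul contDiff_const).contDiffAt contMDiffAt_const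
  have h0 : HasMFDerivAt 𝓘(ℝ, ℝ) (𝓡 12) c 0 0 := by
    have h1 := (hcd.mdifferentiable (by simp) 0).hasMFDerivAt
    have h2 : mfderiv 𝓘(ℝ, ℝ) (𝓡 12) c 0 = 0 := by
      have : tderiv c 0 = 0 := ContinuousLinearMap.ext_ring (by simpa using hk)
      exact this
    rwa [h2] at h1
  have ht (t : ℝ) : HasMFDerivAt 𝓘(ℝ, ℝ) (𝓡 12) c t 0 := by
    let g : EGroup := ofReal (0, t • k)
    have h1 : HasMFDerivAt 𝓘(ℝ, ℝ) 𝓘(ℝ, ℝ) (fun s : ℝ => s - t) t (ContinuousLinearMap.id ℝ ℝ) :=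
      ((hasFDerivAt_id t).sub_const t).hasMFDerivAt
    have h2 : HasMFDerivAt 𝓘(ℝ, ℝ) (𝓡 12) c (t - t) 0 := by rw [sub_self]; exact h0
    have h3 := HasMFDerivAt.comp (f := fun s : ℝ => s - t) t h2 h1
    have h4 := (((S.contMDiff_smul g).mdifferentiable (by simp)) (c (t - t))).hasMFDerivAt.comp t h3
    have h5 : (fun y : M => g • y) ∘ (c ∘ fun s : ℝ => s - t) = c := by
      funext s
      simp only [Function.comp, hc', g]
      rw [← mul_smul, ← ofReal_snd_add, ← add_smul, add_sub_cancel]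
    rw [h5] at h4
    exact HasMFDerivAt.congr_mfderiv h4 (ContinuousLinearMap.ext fun _ =>
      map_zero (mfderiv (𝓡 12) (𝓡 12) (fun y : M => g • y) (c (t - t))))
  have hev : ∀ᶠ t in 𝓝 (0 : ℝ), c t ∈ (chartAt E12 x).source :=
    hcd.continuous.continuousAt.eventually
      ((chartAt E12 x).open_source.mem_nhds (by rw [hcx]; exact mem_chart_source E12 x))
  obtain ⟨ε, hε, hball⟩ := Metric.eventually_nhds_iff_ball.mp hev
  have hψ (t : ℝ) (htb : t ∈ Metric.ball (0 : ℝ) ε) :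
      HasFDerivAt (extChartAt (𝓡 12) x ∘ c) (0 : ℝ →L[ℝ] E12) t := by
    have h1 := (hasMFDerivAt_extChartAt (I := 𝓡 12) (hball t htb)).comp t (ht t)
    exact h1.hasFDerivAt.congr_fderiv (ContinuousLinearMap.comp_zero _)
  have hconst (t : ℝ) (htb : t ∈ Metric.ball (0 : ℝ) ε) : c t = x := by
    have h1 := Metric.isOpen_ball.is_const_of_fderiv_eq_zero (convex_ball (0 : ℝ) ε).isPreconnected
      (fun s hs => (hψ s hs).differentiableAt.differentiableWithinAt)
      (fun s hs => (hψ s hs).fderiv) htb (Metric.mem_ball_self hε)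
    simp only [Function.comp, hcx] at h1
    exact (extChartAt (𝓡 12) x).injOn (by rw [extChartAt_source]; exact hball t htb)
      (mem_extChartAt_source x) h1
  -- The bound by π ensures that a vanishing angle class means a vanishing real angle.
  obtain ⟨t, ht0, htε, htk⟩ : ∃ t : ℝ, 0 < t ∧ t < ε ∧ |t * k.2| < Real.pi := by
    have h1 : Filter.Tendsto (fun t : ℝ => |t * k.2|) (𝓝[>] 0) (𝓝 0) := by
      have : Continuous fun t : ℝ => |t * k.2| := by fun_prop
      have h2 := this.tendsto 0
      simp only [zero_mul, abs_zero] at h2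
      exact h2.mono_left nhdsWithin_le_nhds
    have h2 : ∀ᶠ t : ℝ in 𝓝[>] 0, t < ε := nhdsWithin_le_nhds (eventually_lt_nhds hε)
    have h0 : ∀ᶠ t : ℝ in 𝓝[>] 0, 0 < t := self_mem_nhdsWithin
    obtain ⟨t, h3, h4, h5⟩ :=
      (h0.and (h2.and (h1.eventually (eventually_lt_nhds Real.pi_pos)))).exists
    exact ⟨t, h3, h4, h5⟩
  have h1 := hconst t (by rw [Metric.mem_ball, Real.dist_eq, sub_zero, abs_of_pos ht0]; exact htε)
  rw [hc', hx.isotropy] at h1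
  obtain ⟨φ, hφ⟩ := h1
  have e1 : (0 : Real.Angle) = φ := by simpa [ofReal, diag] using congrArg EGroup.rot hφ
  have e2 : t • k.1 = 0 := congrArg EGroup.trans hφ
  have e3 : ((t * k.2 : ℝ) : Real.Angle) = φ := congrArg EGroup.spin hφ
  rw [← e1] at e3
  have e4 : t * k.2 = 0 := by
    have h5 := (Real.Angle.toReal_coe_eq_self_iff (θ := t * k.2)).mpr
      ⟨(abs_lt.mp htk).1, (abs_lt.mp htk).2.le⟩
    rw [e3, Real.Angle.toReal_zero] at h5
    exact h5.symm
  exact Prod.ext ((smul_eq_zero.mp e2).resolve_left ht0.ne')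
    ((mul_eq_zero.mp e4).resolve_left ht0.ne')

end HamSystem
end ReducedSpace

/-! ### Change of coordinates on the reduced space -/

section Transition

variable {M : Type*} [TopologicalSpace M] [ChartedSpace E12 M] [MulAction EGroup M]

namespace HamSystem

variable {S : HamSystem M} {x : M} {σ σ₁ σ₂ : W4 → M}

/-- K is abelian, so its coadjoint action on its own dual is trivial. -/
theorem J_snd_ofReal_smul (S : HamSystem M) (k : R3 × ℝ) (y : M) :
    (S.J (ofReal (0, k) • y)).2 = (S.J y).2 := by
  refine eq_of_pair_eq fun a θ => ?_
  have := S.J_equivariant (ofReal (0, k)) y (0, a, θ)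
  rwa [Ad_ofReal_snd] at this

namespace IsReducedCoords

theorem contMDiffAt (h : S.IsReducedCoords x σ) : ContMDiffAt 𝓘(ℝ, W4) (𝓡 12) ∞ σ 0 := by
  obtain ⟨U, hU, h0, hsm, -⟩ := h.exists_nhds
  exact hsm.contMDiffAt (hU.mem_nhds h0)

theorem eventually_contMDiffAt (h : S.IsReducedCoords x σ) :
    ∀ᶠ w in 𝓝 (0 : W4), ContMDiffAt 𝓘(ℝ, W4) (𝓡 12) ∞ σ w := by
  obtain ⟨U, hU, h0, hsm, -⟩ := h.exists_nhds
  filter_upwards [hU.mem_nhds h0] with w hw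
  exact hsm.contMDiffAt (hU.mem_nhds hw)

theorem eventually_J_snd (h : S.IsReducedCoords x σ) :
    ∀ᶠ w in 𝓝 (0 : W4), (S.J (σ w)).2 = (S.J x).2 := by
  obtain ⟨U, hU, h0, -, hw⟩ := h.exists_nhds
  filter_upwards [hU.mem_nhds h0] with w hwU
  exact (hw w hwU).1

theorem form_tderiv (h : S.IsReducedCoords x σ) (u v : W4) :
    S.form x (tderiv σ 0 u) (tderiv σ 0 v) = Ω₀ u v := by
  obtain ⟨U, -, h0, -, hw⟩ := h.exists_nhds
  have h1 : S.form (σ 0) (tderiv σ 0 u) (tderiv σ 0 v) = Ω₀ u v := (hw 0 h0).2 u v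
  rwa [h.zero] at h1

/-- The momentum of K is constant along the slice, and its differential is the contraction of Ω with
the generator. -/
theorem form_kGenerator_tderiv (h : S.IsReducedCoords x σ) (k : R3 × ℝ) (u : W4) :
    S.form x (kGenerator x k) (tderiv σ 0 u) = 0 := by
  have h1 := S.form_gen_tderiv (h.contMDiffAt.mdifferentiableAt (by simp)) (0, k) u
  rw [h.zero, gen_snd] at h1
  rw [h1]
  have h2 : (fun w => pair (S.J (σ w)) (0, k)) =ᶠ[𝓝 0] fun _ => pair (S.J x) (0, k) := by
    filter_upwards [h.eventually_J_snd] with w hw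
    simp [pair, hw]
  rw [h2.fderiv_eq]
  simp

end IsReducedCoords

/-- K-orbits are isotropic: the momentum of K is constant along them. -/
theorem form_kGenerator_kGenerator (S : HamSystem M) (x : M) (k k' : R3 × ℝ) :
    S.form x (kGenerator x k) (kGenerator x k') = 0 := by
  have hsm : ContMDiffAt 𝓘(ℝ, LieAlg) (𝓡 12) ∞ (fun η : LieAlg => ofReal η • x) 0 :=
    S.contMDiffAt_ofReal_smul contDiffAt_id contMDiffAt_const
  have h1 := S.form_gen_tderiv (hsm.mdifferentiableAt (by simp)) (0, k) (0, k')
  rw [ofReal_zero, one_smul, gen_snd] at h1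
  refine h1.trans ?_
  have hd : DifferentiableAt ℝ (fun η : LieAlg => pair (S.J (ofReal η • x)) (0, k)) 0 := by
    have := ((S.pair_contMDiff (0, k)).contMDiffAt.comp (0 : LieAlg) hsm).contDiffAt
    exact this.differentiableAt (by simp)
  have h2 := HasFDerivAt.comp (g := fun η : LieAlg => pair (S.J (ofReal η • x)) (0, k))
    (0 : R3 × ℝ) (by rw [map_zero]; exact hd.hasFDerivAt)
    (ContinuousLinearMap.inr ℝ ℝ (R3 × ℝ)).hasFDerivAt
  have h3 : (fun η : LieAlg => pair (S.J (ofReal η • x)) (0, k)) ∘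
      (ContinuousLinearMap.inr ℝ ℝ (R3 × ℝ)) = fun _ => pair (S.J x) (0, k) := by
    funext k'
    simp [pair, S.J_snd_ofReal_smul]
  rw [h3] at h2
  have h4 := h2.unique (hasFDerivAt_const _ _)
  exact congrArg (fun D : (R3 × ℝ) →L[ℝ] ℝ => D k') h4

/-- The linear map `T` is the derivative at `0` of the change of coordinates from `σ₂` to `σ₁`. -/
def IsTransition (x : M) (σ₁ σ₂ : W4 → M) (T : W4 →L[ℝ] W4) : Prop :=
  ∀ u, ∃ k : R3 × ℝ, tderiv σ₂ 0 u - tderiv σ₁ 0 (T u) = kGenerator x k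

/-- K-directions are Ω-orthogonal to the slice, so the error term drops out. The identity determines
T, because `Ω₀` is nondegenerate. -/
theorem IsTransition.form_eq {T : W4 →L[ℝ] W4} (hT : IsTransition x σ₁ σ₂ T)
    (h₁ : S.IsReducedCoords x σ₁) (u v : W4) :
    Ω₀ (T u) v = S.form x (tderiv σ₂ 0 u) (tderiv σ₁ 0 v) := by
  obtain ⟨k, hk⟩ := hT u
  rw [← h₁.form_tderiv, eq_add_of_sub_eq hk, map_add, LinearMap.add_apply,
    h₁.form_kGenerator_tderiv, zero_add]

theorem IsTransition.symplectic {T : W4 →L[ℝ] W4} (hT : IsTransition x σ₁ σ₂ T)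
    (h₁ : S.IsReducedCoords x σ₁) (h₂ : S.IsReducedCoords x σ₂) (u v : W4) :
    Ω₀ (T u) (T v) = Ω₀ u v := by
  obtain ⟨k, hk⟩ := hT v
  rw [hT.form_eq h₁, ← h₂.form_tderiv, eq_add_of_sub_eq hk, map_add,
    S.form_swap _ _ (kGenerator x k), h₂.form_kGenerator_tderiv, neg_zero, zero_add]

theorem IsTransition.trans {σ₃ : W4 → M} {T T' : W4 →L[ℝ] W4} (hT : IsTransition x σ₁ σ₂ T)
    (hT' : IsTransition x σ₂ σ₃ T') : IsTransition x σ₁ σ₃ (T.comp T') := by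
  intro u
  obtain ⟨k, hk⟩ := hT (T' u)
  obtain ⟨k', hk'⟩ := hT' u
  refine ⟨k' + k, ?_⟩
  rw [map_add, ← hk, ← hk']
  simp

theorem IsTransition.eq {T T' : W4 →L[ℝ] W4} (hT : IsTransition x σ₁ σ₂ T)
    (hT' : IsTransition x σ₁ σ₂ T') (h₁ : S.IsReducedCoords x σ₁) : T = T' := by
  ext1 u
  exact Ω₀_ext fun v => by rw [hT.form_eq h₁, hT'.form_eq h₁]

variable [IsManifold (𝓡 12) ∞ M]

/-- The tangent space of the level set of `J^K` is the sum of the tangent spaces of the slice and of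
the `K`-orbit. -/
theorem IsReducedCoords.exists_decomposition (hx : S.IsAxisymmetricRE x)
    (h : S.IsReducedCoords x σ) {z : E12} (hz : ∀ k, S.form x (kGenerator x k) z = 0) :
    ∃ (u : W4) (k : R3 × ℝ), z = tderiv σ 0 u + kGenerator x k := by
  let Φ : (W4 × (R3 × ℝ)) →ₗ[ℝ] E12 :=
    LinearMap.coprod (tderiv σ 0 : W4 →ₗ[ℝ] E12) (kGenerator x : (R3 × ℝ) →ₗ[ℝ] E12)
  have hΦ (u : W4) (k : R3 × ℝ) : Φ (u, k) = tderiv σ 0 u + kGenerator x k := rfl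
  have hinj : Function.Injective Φ := by
    rw [injective_iff_map_eq_zero]
    rintro ⟨u, k⟩ h0
    rw [hΦ] at h0
    have hu : u = 0 := by
      refine Ω₀_nondegenerate fun v => ?_
      rw [← h.form_tderiv, eq_neg_of_add_eq_zero_left h0, map_neg, LinearMap.neg_apply,
        h.form_kGenerator_tderiv, neg_zero]
    rw [hu, map_zero, zero_add] at h0
    rw [hu, (injective_iff_map_eq_zero _).mp (kGenerator_injective hx) k h0]
    rfl
  let K : Submodule ℝ E12 := LinearMap.range (kGenerator x : (R3 × ℝ) →ₗ[ℝ] E12)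
  let Z : Submodule ℝ E12 := (S.form x).orthogonal K
  have hle : LinearMap.range Φ ≤ Z := by
    rintro _ ⟨⟨u, k⟩, rfl⟩
    rw [LinearMap.BilinForm.mem_orthogonal_iff]
    rintro _ ⟨k', rfl⟩
    change S.form x (kGenerator x k') _ = 0
    rw [hΦ, map_add, h.form_kGenerator_tderiv, S.form_kGenerator_kGenerator, add_zero]
  -- Both dimensions are 8: slice plus orbit gives 4 + 4, and the orthogonal complement of the
  -- 4-dimensional orbit direction gives 12 - 4.
  have hfin : Module.finrank ℝ (LinearMap.range Φ) = Module.finrank ℝ Z := by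
    rw [LinearMap.finrank_range_of_inj hinj,
      LinearMap.BilinForm.finrank_orthogonal (S.form_nondegenerate x),
      LinearMap.finrank_range_of_inj (kGenerator_injective hx)]
    simp
  have hzZ : z ∈ Z := by
    rw [LinearMap.BilinForm.mem_orthogonal_iff]
    rintro _ ⟨k', rfl⟩
    exact hz k'
  rw [← Submodule.eq_of_le_of_finrank_eq hle hfin] at hzZ
  obtain ⟨⟨u, k⟩, rfl⟩ := hzZ
  exact ⟨u, k, rfl⟩

/-- Tangent vectors of the second slice lie in the tangent space of the level set, which the first
slice and the K-orbit span. Linearity of the pointwise choices is automatic, since pairing with the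
first slice determines them. -/
theorem exists_isTransition (hx : S.IsAxisymmetricRE x) (h₁ : S.IsReducedCoords x σ₁)
    (h₂ : S.IsReducedCoords x σ₂) : ∃ T, IsTransition x σ₁ σ₂ T := by
  have hdec (u : W4) : ∃ w : W4, ∃ k : R3 × ℝ, tderiv σ₂ 0 u - tderiv σ₁ 0 w = kGenerator x k := by
    obtain ⟨w, k, hwk⟩ := h₁.exists_decomposition hx (z := tderiv σ₂ 0 u)
      (fun k => h₂.form_kGenerator_tderiv k u)
    exact ⟨w, k, by rw [hwk]; abel⟩
  choose T k hT using hdec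
  have hform (u v : W4) : Ω₀ (T u) v = S.form x (tderiv σ₂ 0 u) (tderiv σ₁ 0 v) := by
    rw [← h₁.form_tderiv, eq_add_of_sub_eq (hT u), map_add, LinearMap.add_apply,
      h₁.form_kGenerator_tderiv, zero_add]
  let T' : W4 →ₗ[ℝ] W4 :=
    { toFun := T
      map_add' := fun u u' => Ω₀_ext fun v => by
        rw [Ω₀_add_left, hform, hform, hform, map_add, map_add, LinearMap.add_apply]
      map_smul' := fun c u => Ω₀_ext fun v => by
        rw [RingHom.id_apply, Ω₀_smul_left, hform, hform, map_smul, map_smul,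
          LinearMap.smul_apply, smul_eq_mul] }
  exact ⟨LinearMap.toContinuousLinearMap T', fun u => ⟨k u, hT u⟩⟩

/-- The Hessian at a critical point of a function that is invariant under `K` on the level set of
`J^K` does not depend on the coordinates of the reduced space. -/
theorem IsTransition.hessian_eq {T : W4 →L[ℝ] W4} (hT : IsTransition x σ₁ σ₂ T)
    (hx : S.IsAxisymmetricRE x) (h₁ : S.IsReducedCoords x σ₁) (h₂ : S.IsReducedCoords x σ₂)
    {F : M → ℝ} (hF : ContMDiff (𝓡 12) 𝓘(ℝ, ℝ) ∞ F)
    (hcrit : ∀ v : TangentSpace (𝓡 12) x, mfderiv (𝓡 12) 𝓘(ℝ, ℝ) F x v = 0)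
    (hinv : ∀ (k : R3 × ℝ) (y : M), (S.J y).2 = (S.J x).2 → F (ofReal (0, k) • y) = F y)
    (u v : W4) : hessian (F ∘ σ₂) u v = hessian (F ∘ σ₁) (T u) (T v) := by
  -- A linear left inverse of the infinitesimal action makes the K-correction linear in w.
  obtain ⟨g, hg⟩ := LinearMap.exists_leftInverse_of_injective
    (kGenerator x : (R3 × ℝ) →ₗ[ℝ] E12) (LinearMap.ker_eq_bot.mpr (kGenerator_injective hx))
  let κ : W4 →L[ℝ] LieAlg := (ContinuousLinearMap.inr ℝ ℝ (R3 × ℝ)).comp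
    ((LinearMap.toContinuousLinearMap g).comp (tderiv σ₂ 0 - (tderiv σ₁ 0).comp T))
  have hκ (u : W4) : ∃ k, κ u = (0, k) ∧ tderiv σ₂ 0 u - tderiv σ₁ 0 (T u) = kGenerator x k := by
    refine ⟨_, rfl, ?_⟩
    obtain ⟨k, hk⟩ := hT u
    have h3 : g (kGenerator x k) = k := LinearMap.congr_fun hg k
    change _ = kGenerator x (g (tderiv σ₂ 0 u - tderiv σ₁ 0 (T u)))
    rw [hk, h3]
  -- Moving σ₁ ∘ T along K gives τ the same first derivative at 0 as σ₂, while K-invariance keeps F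
  -- ∘ τ equal to F ∘ σ₁ ∘ T near 0.
  let τ : W4 → M := fun w => ofReal (κ w) • σ₁ (T w)
  have hσT : ContMDiffAt 𝓘(ℝ, W4) (𝓡 12) ∞ (σ₁ ∘ T) 0 :=
    ContMDiffAt.comp (I' := 𝓘(ℝ, W4)) 0 (by rw [map_zero]; exact h₁.contMDiffAt)
      T.contDiff.contMDiff.contMDiffAt
  have hσT0 : (σ₁ ∘ T) 0 = x := by rw [Function.comp, map_zero, h₁.zero]
  have hτ : ContMDiffAt 𝓘(ℝ, W4) (𝓡 12) ∞ τ 0 :=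
    S.contMDiffAt_ofReal_smul κ.contDiff.contDiffAt hσT
  have hτ0 : τ 0 = x := by
    simp only [τ, map_zero, ofReal_zero, one_smul, h₁.zero]
  have hσTd (w : W4) : tderiv (σ₁ ∘ T) 0 w = tderiv σ₁ 0 (T w) := by
    have h3 : MDifferentiableAt 𝓘(ℝ, W4) (𝓡 12) σ₁ (T 0) := by
      rw [map_zero]; exact h₁.contMDiffAt.mdifferentiableAt (by simp)
    have h4 := mfderiv_comp_apply (I' := 𝓘(ℝ, W4)) (0 : W4) h3
      T.differentiableAt.mdifferentiableAt w
    rw [mfderiv_eq_fderiv, T.fderiv, map_zero] at h4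
    exact h4
  have hτd (w : W4) : tderiv τ 0 w = tderiv σ₂ 0 w := by
    have h3 := S.tderiv_ofReal_smul (f := σ₁ ∘ T) κ.contDiff.contDiffAt hσT (map_zero κ) hσT0 w
    rw [hσTd, κ.fderiv] at h3
    obtain ⟨k, hk, hk'⟩ := hκ w
    rw [hk, gen_snd, ← hk', sub_add_cancel] at h3
    exact h3
  have h3 : F ∘ τ =ᶠ[𝓝 0] (F ∘ σ₁) ∘ T := by
    have h4 : Filter.Tendsto T (𝓝 0) (𝓝 0) := by
      have := T.continuous.tendsto 0
      rwa [map_zero] at this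
    filter_upwards [h4.eventually h₁.eventually_J_snd] with w hw
    obtain ⟨k, hk, -⟩ := hκ w
    simp only [τ, Function.comp, hk]
    exact hinv k _ hw
  have h4 : ContDiffAt ℝ ∞ (F ∘ σ₁) (T 0) := by
    rw [map_zero]
    exact (hF.contMDiffAt.comp 0 h₁.contMDiffAt).contDiffAt
  have h5 := fderiv_fderiv_comp_clm T (h4.of_le (by norm_cast)) u v
  rw [map_zero] at h5
  rw [hessian, hessian, ← h5, ← h3.fderiv.fderiv_eq,
    fderiv_fderiv_comp_of_critical hF hcrit h₂.zero h₂.contMDiffAt,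
    fderiv_fderiv_comp_of_critical hF hcrit hτ0 hτ, hτd, hτd]

end HamSystem
end Transition

/-! ### Hessians, linearization and the diagonal circle on the reduced space -/

section Reduction

variable {M : Type*} [TopologicalSpace M] [ChartedSpace E12 M] [MulAction EGroup M]

namespace HamSystem

variable {S : HamSystem M} {x : M} {σ σ₁ σ₂ : W4 → M} {T : W4 →L[ℝ] W4}

/-- The symplectic form is invariant under the group action. -/
theorem form_smul (S : HamSystem M) (g : EGroup) {V V' : Type*} [NormedAddCommGroup V]
    [NormedSpace ℝ V] [NormedAddCommGroup V'] [NormedSpace ℝ V'] {f : V → M} {f' : V' → M} {v : V}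
    {v' : V'} {y : M} (hf : MDifferentiableAt 𝓘(ℝ, V) (𝓡 12) f v)
    (hf' : MDifferentiableAt 𝓘(ℝ, V') (𝓡 12) f' v') (hv : f v = y) (hv' : f' v' = y)
    (u : V) (u' : V') :
    S.form (g • y) (tderiv (fun w => g • f w) v u) (tderiv (fun w => g • f' w) v' u') =
      S.form y (tderiv f v u) (tderiv f' v' u') := by
  have hg : MDifferentiableAt (𝓡 12) (𝓡 12) (fun z : M => g • z) y :=
    (S.contMDiff_smul g).mdifferentiable (by simp) y
  have h1 : tderiv (fun w => g • f w) v u =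
      (mfderiv (𝓡 12) (𝓡 12) (fun z : M => g • z) y : E12 →L[ℝ] E12) (tderiv f v u) :=
    mfderiv_comp_apply_of_eq v hg hf hv u
  have h2 : tderiv (fun w => g • f' w) v' u' =
      (mfderiv (𝓡 12) (𝓡 12) (fun z : M => g • z) y : E12 →L[ℝ] E12) (tderiv f' v' u') :=
    mfderiv_comp_apply_of_eq v' hg hf' hv' u'
  have h3 := congrArg (fun ω' : E12 [⋀^Fin 2]→L[ℝ] ℝ => ω' ![tderiv f v u, tderiv f' v' u'])
    (S.Ω_invariant g y)
  rw [h1, h2]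
  refine Eq.trans ?_ h3
  change (S.Ω (g • y) : E12 [⋀^Fin 2]→L[ℝ] ℝ) _ = (S.Ω (g • y) : E12 [⋀^Fin 2]→L[ℝ] ℝ) _
  congr 1
  ext i : 1
  fin_cases i <;> rfl

theorem diag_smul (hx : S.IsAxisymmetricRE x) (φ : Real.Angle) : diag φ • x = x :=
  (hx.isotropy _).mpr ⟨φ, rfl⟩

/-- SO(2)_D acts on the K-component of the momentum alone, and it fixes the value at x because it
fixes x. -/
theorem J_snd_diag_smul (hx : S.IsAxisymmetricRE x) (φ : Real.Angle) {y : M}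
    (hy : (S.J y).2 = (S.J x).2) : (S.J (diag φ • y)).2 = (S.J x).2 := by
  refine eq_of_pair_eq fun a θ => ?_
  have h1 := S.J_equivariant (diag φ) y (0, rotate (-φ) a, θ)
  have h2 := S.J_equivariant (diag φ) x (0, rotate (-φ) a, θ)
  rw [Ad_diag_snd, rotate_neg_rotate] at h1 h2
  rw [diag_smul hx] at h2
  rw [h1, h2]
  simp [pair, hy]

/-- The momentum of an axisymmetric relative equilibrium is parallel to the symmetry axis. -/
theorem J_trans_eq_zero (hx : S.IsAxisymmetricRE x) :
    (S.J x).2.1 0 = 0 ∧ (S.J x).2.1 1 = 0 := by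
  -- The half turn about the axis reverses the horizontal components.
  have h (a : R3) : pair (S.J x) (0, rotate Real.pi a, 0) = pair (S.J x) (0, a, 0) := by
    have h1 := S.J_equivariant (diag Real.pi) x (0, a, 0)
    rwa [Ad_diag_snd, diag_smul hx] at h1
  have h0 := h !₂[1, 0, 0]
  have h1 := h !₂[0, 1, 0]
  simp [pair, rotate, PiLp.inner_apply, Fin.sum_univ_three] at h0 h1
  constructor <;> linarith

/-- The momentum of the diagonal subgroup `SO(2)_D`. -/
def diagMomentum (S : HamSystem M) (y : M) : ℝ := (S.J y).1 + (S.J y).2.2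

theorem diagMomentum_eq (S : HamSystem M) (y : M) : S.diagMomentum y = pair (S.J y) (1, 0, 1) := by
  simp [diagMomentum, pair]

theorem diagMomentum_contMDiff (S : HamSystem M) :
    ContMDiff (𝓡 12) 𝓘(ℝ, ℝ) ∞ S.diagMomentum := by
  rw [funext S.diagMomentum_eq]
  exact S.pair_contMDiff _

/-- A translation changes this momentum only by pairing J^a with a horizontal vector, and on the
level set J^a is vertical. -/
theorem diagMomentum_ofReal_smul (hx : S.IsAxisymmetricRE x) (k : R3 × ℝ) {y : M}
    (hy : (S.J y).2 = (S.J x).2) : S.diagMomentum (ofReal (0, k) • y) = S.diagMomentum y := by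
  have h1 := S.J_equivariant (ofReal (0, k)) y (1, 0, 1)
  obtain ⟨h2, h3⟩ := J_trans_eq_zero hx
  have hAd : Ad (ofReal (0, k)) (1, 0, 1) = (1, -!₂[-k.1 1, k.1 0, 0], 1) := by
    simp [Ad, ofReal, rotate_zero]
  have h4 := S.J_snd_ofReal_smul k y
  rw [hy] at h4
  rw [S.diagMomentum_eq y, ← h1, hAd]
  generalize ofReal (0, k) • y = z at h4
  simp [diagMomentum, pair, PiLp.inner_apply, Fin.sum_univ_three, h4, h2, h3]

theorem hessian_congr_of_eventuallyEq_sub_const {f g : W4 → ℝ} {c : ℝ}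
    (h : f =ᶠ[𝓝 0] fun w => g w - c) (u v : W4) : hessian f u v = hessian g u v := by
  have h1 : fderiv ℝ (fun w => g w - c) = fderiv ℝ g := funext fun w => fderiv_sub_const c
  rw [hessian, hessian, h.fderiv.fderiv_eq, h1]

namespace IsReducedCoords

theorem redH_contDiffAt (h : S.IsReducedCoords x σ) : ContDiffAt ℝ ∞ (S.redH σ) 0 :=
  (S.H_smooth.contMDiffAt.comp 0 h.contMDiffAt).contDiffAt

theorem redJ_contDiffAt (h : S.IsReducedCoords x σ) : ContDiffAt ℝ ∞ (S.redJ σ) 0 :=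
  (S.diagMomentum_contMDiff.contMDiffAt.comp 0 h.contMDiffAt).contDiffAt

theorem form_linearization (h : S.IsReducedCoords x σ) (u v : W4) :
    Ω₀ (S.linearization σ u) v = hessian (S.redH σ) u v := by
  let D' : (W4 →L[ℝ] ℝ) →ₗ[ℝ] W4 :=
    { toFun := fun l => JJ ((InnerProductSpace.toDual ℝ W4).symm l)
      map_add' := fun l l' => by
        rw [map_add]
        ext i; fin_cases i <;> simp [JJ] <;> ring
      map_smul' := fun c l => by
        rw [map_smulₛₗ, RingHom.id_apply, conj_trivial]
        ext i; fin_cases i <;> simp [JJ] }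
  let D : (W4 →L[ℝ] ℝ) →L[ℝ] W4 := LinearMap.toContinuousLinearMap D'
  have hD (w : W4) : JJ (gradient (S.redH σ) w) = D (fderiv ℝ (S.redH σ) w) := rfl
  have h1 : HasFDerivAt (fderiv ℝ (S.redH σ)) (fderiv ℝ (fderiv ℝ (S.redH σ)) 0) 0 :=
    ((h.redH_contDiffAt.fderiv_right (m := 1) (by norm_cast)).differentiableAt
      (by simp)).hasFDerivAt
  have h2 := D.hasFDerivAt.comp (0 : W4) h1
  have h3 : S.linearization σ = D.comp (fderiv ℝ (fderiv ℝ (S.redH σ)) 0) := by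
    rw [linearization]
    simp only [hD]
    exact h2.fderiv
  rw [h3]
  change Ω₀ (JJ ((InnerProductSpace.toDual ℝ W4).symm (fderiv ℝ (fderiv ℝ (S.redH σ)) 0 u))) v = _
  rw [Ω₀_JJ, InnerProductSpace.toDual_symm_apply, hessian]

theorem hessian_redH_symm (h : S.IsReducedCoords x σ) (u v : W4) :
    hessian (S.redH σ) u v = hessian (S.redH σ) v u :=
  (h.redH_contDiffAt.isSymmSndFDerivAt (by
    rw [minSmoothness_of_isRCLikeNormedField]; norm_cast)) u v

theorem linearization_skew (h : S.IsReducedCoords x σ) (u v : W4) :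
    Ω₀ (S.linearization σ u) v = -Ω₀ u (S.linearization σ v) := by
  rw [h.form_linearization, h.hessian_redH_symm, ← h.form_linearization, Ω₀_swap]

theorem hessian_redH_add_redJ (h : S.IsReducedCoords x σ) (c : ℝ) (u v : W4) :
    hessian (fun w => S.redH σ w + c * S.redJ σ w) u v =
      hessian (S.redH σ) u v + c * hessian (S.redJ σ) u v := by
  have h1 : fderiv ℝ (fun w => S.redH σ w + c * S.redJ σ w) =ᶠ[𝓝 0]
      fun w => fderiv ℝ (S.redH σ) w + c • fderiv ℝ (S.redJ σ) w := by
    filter_upwards [(h.redH_contDiffAt.of_le (m := 1) (by norm_cast)).eventually (by simp),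
      (h.redJ_contDiffAt.of_le (m := 1) (by norm_cast)).eventually (by simp)] with w hw hw'
    have d1 := (hw.differentiableAt (by simp)).hasFDerivAt
    have d2 := (hw'.differentiableAt (by simp)).hasFDerivAt
    exact (d1.add (d2.const_mul c)).fderiv
  have d1 := ((h.redH_contDiffAt.fderiv_right (m := 1) (by norm_cast)).differentiableAt
    (by simp)).hasFDerivAt
  have d2 := ((h.redJ_contDiffAt.fderiv_right (m := 1) (by norm_cast)).differentiableAt
    (by simp)).hasFDerivAt
  rw [hessian, h1.fderiv_eq]
  exact congrArg (fun D : W4 →L[ℝ] W4 →L[ℝ] ℝ => D u v) (d1.add (d2.const_smul c)).fderiv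

/-- With the translated slice admissible, the linearized action becomes a family of transition maps,
and every result on transitions applies to it. -/
theorem diag_smul (hx : S.IsAxisymmetricRE x) (h : S.IsReducedCoords x σ) (φ : Real.Angle) :
    S.IsReducedCoords x (fun w => diag φ • σ w) := by
  refine ⟨by rw [h.zero, HamSystem.diag_smul hx], ?_⟩
  obtain ⟨U, hU, h0, hsm, hw⟩ := h.exists_nhds
  refine ⟨U, hU, h0, (S.contMDiff_smul (diag φ)).comp_contMDiffOn hsm, fun w hwU => ⟨?_, ?_⟩⟩
  · exact J_snd_diag_smul hx φ (hw w hwU).1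
  · intro u v
    have hd := (hsm.contMDiffAt (hU.mem_nhds hwU)).mdifferentiableAt (by simp)
    exact (S.form_smul (diag φ) hd hd rfl rfl u v).trans ((hw w hwU).2 u v)

end IsReducedCoords

variable [IsManifold (𝓡 12) ∞ M]

/-- The point x is critical for the momentum of SO(2)_D because the generator of its isotropy group
vanishes there. -/
theorem IsTransition.hessian_redJ (hT : IsTransition x σ₁ σ₂ T)
    (hx : S.IsAxisymmetricRE x) (h₁ : S.IsReducedCoords x σ₁) (h₂ : S.IsReducedCoords x σ₂)
    (u v : W4) : hessian (S.redJ σ₂) u v = hessian (S.redJ σ₁) (T u) (T v) := by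
  refine hT.hessian_eq hx h₁ h₂ S.diagMomentum_contMDiff (fun (v : E12) => ?_)
    (fun k y hy => diagMomentum_ofReal_smul hx k hy) u v
  rw [funext S.diagMomentum_eq]
  have h := S.form_gen x (1, 0, 1) v
  rw [gen_diag hx, map_zero, LinearMap.zero_apply] at h
  exact h.symm

/-- H itself need not be critical at x. Subtracting the isotropy direction from ξ leaves an element
k₀ of the Lie algebra of K with the same velocity at x, and the augmented function H - ⟨J, k₀⟩ is
critical there. On a slice it differs from H by a constant. -/
theorem IsTransition.hessian_redH (hT : IsTransition x σ₁ σ₂ T)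
    (hx : S.IsAxisymmetricRE x) (h₁ : S.IsReducedCoords x σ₁) (h₂ : S.IsReducedCoords x σ₂)
    (u v : W4) : hessian (S.redH σ₂) u v = hessian (S.redH σ₁) (T u) (T v) := by
  obtain ⟨ξ, hξ⟩ := hx.relEq
  let k₀ : R3 × ℝ := (ξ.2.1, ξ.2.2 - ξ.1)
  have hk₀ : ξ = (0, k₀) + ξ.1 • ((1 : ℝ), (0 : R3), (1 : ℝ)) := by
    ext <;> simp [k₀]
  have hgen : gen ξ x = gen (0, k₀) x := by
    have h3 : gen ξ x = gen (0, k₀) x + ξ.1 • gen (1, 0, 1) x := by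
      conv_lhs => rw [hk₀]
      exact (map_add (mfderiv 𝓘(ℝ, LieAlg) (𝓡 12) (fun η : LieAlg => ofReal η • x) 0) _ _).trans
        (congrArg _ (map_smul _ _ _))
    rw [h3, gen_diag hx, smul_zero, add_zero]
  let F : M → ℝ := fun y => S.H y - pair (S.J y) (0, k₀)
  have hF : ContMDiff (𝓡 12) 𝓘(ℝ, ℝ) ∞ F := S.H_smooth.sub (S.pair_contMDiff _)
  have hcrit : ∀ v : TangentSpace (𝓡 12) x, mfderiv (𝓡 12) 𝓘(ℝ, ℝ) F x v = 0 := by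
    intro (v : E12)
    have d1 := (S.H_smooth.mdifferentiable (by simp) x).hasMFDerivAt
    have d2 := ((S.pair_contMDiff (0, k₀)).mdifferentiable (by simp) x).hasMFDerivAt
    have d3 := (d1.sub d2).mfderiv
    have h3 : S.form x (gen ξ x) v =
      (mfderiv (𝓡 12) 𝓘(ℝ, ℝ) S.H x : E12 →L[ℝ] ℝ) v := hξ v
    rw [hgen, S.form_gen] at h3
    have h4 := congrArg (fun D : E12 →L[ℝ] ℝ => D v) d3
    exact h4.trans (sub_eq_zero.mpr h3.symm)
  have hinv : ∀ (k : R3 × ℝ) (y : M), (S.J y).2 = (S.J x).2 → F (ofReal (0, k) • y) = F y := by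
    intro k y _
    simp only [F, S.H_invariant]
    congr 1
    simp [pair, S.J_snd_ofReal_smul]
  have hcongr {σ : W4 → M} (h : S.IsReducedCoords x σ) (u v : W4) :
      hessian (F ∘ σ) u v = hessian (S.redH σ) u v := by
    apply hessian_congr_of_eventuallyEq_sub_const (c := pair (S.J x) (0, k₀))
    filter_upwards [h.eventually_J_snd] with w hw
    simp [F, redH, pair, hw]
  rw [← hcongr h₁, ← hcongr h₂]
  exact hT.hessian_eq hx h₁ h₂ hF hcrit hinv u v

theorem IsTransition.linearization_comm (hT : IsTransition x σ₁ σ₂ T)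
    (hx : S.IsAxisymmetricRE x) (h₁ : S.IsReducedCoords x σ₁) (h₂ : S.IsReducedCoords x σ₂)
    (u : W4) : T (S.linearization σ₂ u) = S.linearization σ₁ (T u) := by
  obtain ⟨T', hT'⟩ := exists_isTransition hx h₂ h₁
  refine Ω₀_ext fun w => ?_
  have h3 : T (T' w) = w := by
    have h4 : IsTransition x σ₁ σ₁ (ContinuousLinearMap.id ℝ W4) := fun u => ⟨0, by simp⟩
    have h5 := (hT.trans hT').eq h4 h₁
    exact congrArg (fun D : W4 →L[ℝ] W4 => D w) h5
  rw [← h3, hT.symplectic h₁ h₂, h₂.form_linearization, hT.hessian_redH hx h₁ h₂,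
    h₁.form_linearization]

/-- A transition is determined by pairings under Ω, and these are preserved when both slices are
translated. -/
theorem IsTransition.diag_smul (hT : IsTransition x σ₁ σ₂ T) (hx : S.IsAxisymmetricRE x)
    (h₁ : S.IsReducedCoords x σ₁) (h₂ : S.IsReducedCoords x σ₂) (φ : Real.Angle) :
    IsTransition x (fun w => diag φ • σ₁ w) (fun w => diag φ • σ₂ w) T := by
  obtain ⟨T', hT'⟩ := exists_isTransition hx (h₁.diag_smul hx φ) (h₂.diag_smul hx φ)
  have h3 : T' = T := by
    ext1 u
    refine Ω₀_ext fun v => ?_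
    rw [hT'.form_eq (h₁.diag_smul hx φ), hT.form_eq h₁]
    have := S.form_smul (diag φ) (h₂.contMDiffAt.mdifferentiableAt (by simp))
      (h₁.contMDiffAt.mdifferentiableAt (by simp)) h₂.zero h₁.zero u v
    rwa [HamSystem.diag_smul hx] at this
  rwa [h3] at hT'

theorem exists_isLinearizedAction (hx : S.IsAxisymmetricRE x) (h : S.IsReducedCoords x σ) :
    ∃ L : Real.Angle → W4 →L[ℝ] W4, IsLinearizedAction x σ L := by
  choose L hL using fun φ => exists_isTransition hx h (h.diag_smul hx φ)
  refine ⟨L, fun φ u => ?_⟩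
  obtain ⟨⟨a, θ⟩, hk⟩ := hL φ u
  exact ⟨a, θ, hk⟩

end HamSystem

theorem IsLinearizedAction.isTransition {x : M} {σ : W4 → M} {L : Real.Angle → W4 →L[ℝ] W4}
    (hL : IsLinearizedAction x σ L) (φ : Real.Angle) :
    HamSystem.IsTransition x σ (fun w => diag φ • σ w) (L φ) := by
  intro u
  obtain ⟨a, θ, h⟩ := hL φ u
  exact ⟨(a, θ), h⟩

end Reduction

/-! ### The generator of the linearized action and the Hessian of the momentum -/

section InfinitesimalGenerator

/-- The coordinates of a vector are, up to sign, its pairings with the standard basis, so weak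
differentiability suffices. -/
theorem hasDerivAt_of_Ω₀ {z : ℝ → W4} {z' : W4} {t : ℝ}
    (h : ∀ v, HasDerivAt (fun s => Ω₀ (z s) v) (Ω₀ z' v) t) : HasDerivAt z z' t := by
  let e (i : Fin 4) : W4 := EuclideanSpace.single i 1
  have hdec (w : W4) : w = Ω₀ w (e 2) • e 0 + Ω₀ w (e 3) • e 1 - Ω₀ w (e 0) • e 2 -
      Ω₀ w (e 1) • e 3 := by
    ext i; fin_cases i <;> simp [Ω₀, e]
  have h1 := ((((h (e 2)).smul_const (e 0)).add ((h (e 3)).smul_const (e 1))).sub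
    ((h (e 0)).smul_const (e 2))).sub ((h (e 1)).smul_const (e 3))
  refine (h1.congr_deriv (hdec z').symm).congr_of_eventuallyEq (Filter.Eventually.of_forall ?_)
  exact fun s => hdec (z s)

theorem ofReal_smul_diag (t : ℝ) : ofReal (t • ((1 : ℝ), (0 : R3), (1 : ℝ))) = diag t := by
  simp [ofReal, diag]

variable {M : Type*} [TopologicalSpace M] [ChartedSpace E12 M] [MulAction EGroup M]
  {S : HamSystem M} {x : M} {σ : W4 → M}

namespace HamSystem

theorem IsReducedCoords.eventually_mem_source (h : S.IsReducedCoords x σ) :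
    ∀ᶠ w in 𝓝 (0 : W4), σ w ∈ (chartAt E12 x).source :=
  h.contMDiffAt.continuousAt.eventually
    ((chartAt E12 x).open_source.mem_nhds (by rw [h.zero]; exact mem_chart_source E12 x))

theorem IsReducedCoords.zero_mem_source (h : S.IsReducedCoords x σ) :
    σ 0 ∈ (chartAt E12 x).source := h.eventually_mem_source.self_of_nhds

variable [IsManifold (𝓡 12) ∞ M]

theorem form_eq_inChart (S : HamSystem M) {x y : M} (hy : y ∈ (chartAt E12 x).source) (a b : E12) :
    S.form y a b = S.Ω.inChart x (extChartAt (𝓡 12) x y)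
      ![(mfderiv (𝓡 12) 𝓘(ℝ, E12) (extChartAt (𝓡 12) x) y : E12 →L[ℝ] E12) a,
        (mfderiv (𝓡 12) 𝓘(ℝ, E12) (extChartAt (𝓡 12) x) y : E12 →L[ℝ] E12) b] := by
  have : IsManifold (𝓡 12) 1 M := IsManifold.of_le (n := ∞) (by norm_cast)
  have hy' : y ∈ (extChartAt (𝓡 12) x).source := by rwa [extChartAt_source]
  have h1 := mfderivWithin_extChartAt_symm_comp_mfderiv_extChartAt' (I := 𝓡 12) hy'
  rw [ModelWithCorners.range_eq_univ, mfderivWithin_univ] at h1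
  have h2 (v : E12) : (mfderiv 𝓘(ℝ, E12) (𝓡 12) (extChartAt (𝓡 12) x).symm
      (extChartAt (𝓡 12) x y) : E12 →L[ℝ] E12)
      ((mfderiv (𝓡 12) 𝓘(ℝ, E12) (extChartAt (𝓡 12) x) y : E12 →L[ℝ] E12) v) = v :=
    congrArg (fun D : E12 →L[ℝ] E12 => D v) h1
  have h3 : ∀ z, z = y → S.form z a b = S.form y a b := by rintro z rfl; rfl
  rw [← h3 _ ((extChartAt (𝓡 12) x).left_inv hy')]
  conv_lhs => rw [← h2 a, ← h2 b]
  change (S.Ω ((extChartAt (𝓡 12) x).symm (extChartAt (𝓡 12) x y)) : E12 [⋀^Fin 2]→L[ℝ] ℝ) _ =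
    (S.Ω ((extChartAt (𝓡 12) x).symm (extChartAt (𝓡 12) x y)) : E12 [⋀^Fin 2]→L[ℝ] ℝ) _
  congr 1
  ext i : 1
  fin_cases i <;> rfl

theorem form_eq_inChart_self (S : HamSystem M) (x : M) (a b : E12) :
    S.form x a b = S.Ω.inChart x (extChartAt (𝓡 12) x x) ![a, b] := by
  have : IsManifold (𝓡 12) 1 M := IsManifold.of_le (n := ∞) (by norm_cast)
  rw [S.form_eq_inChart (mem_chart_source E12 x), mfderiv_extChartAt_self]
  rfl

/-- The action of `SO(2)_D` on a slice, read in the chart at `x`. -/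
def diagChart (x : M) (σ : W4 → M) : ℝ × W4 → E12 :=
  extChartAt (𝓡 12) x ∘ fun p : ℝ × W4 => ofReal (p.1 • ((1 : ℝ), (0 : R3), (1 : ℝ))) • σ p.2

theorem diagChart_contDiffAt (S : HamSystem M) {w : W4} (hσ : ContMDiffAt 𝓘(ℝ, W4) (𝓡 12) ∞ σ w)
    (hw : σ w ∈ (chartAt E12 x).source) : ContDiffAt ℝ ∞ (diagChart x σ) (0, w) := by
  refine contDiffAt_extChartAt_comp ?_ ?_
  · simp only [zero_smul, ofReal_zero, one_smul]
    exact hw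
  · have h : ContMDiffAt 𝓘(ℝ, ℝ × W4) (𝓡 12) ∞ (σ ∘ Prod.snd) ((0 : ℝ), w) :=
      ContMDiffAt.comp (I' := 𝓘(ℝ, W4)) ((0 : ℝ), w) hσ contDiffAt_snd.contMDiffAt
    exact S.contMDiffAt_ofReal_smul (contDiffAt_fst.smul contDiffAt_const) h

/-- The momentum map identity in the chart at `x`. -/
theorem fderiv_redJ_eq (S : HamSystem M) {w : W4} (hσ : ContMDiffAt 𝓘(ℝ, W4) (𝓡 12) ∞ σ w)
    (hw : σ w ∈ (chartAt E12 x).source) (v : W4) :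
    fderiv ℝ (S.redJ σ) w v = S.Ω.inChart x (extChartAt (𝓡 12) x (σ w))
      ![fderiv ℝ (diagChart x σ) (0, w) (1, 0), fderiv ℝ (diagChart x σ) (0, w) (0, v)] := by
  have : IsManifold (𝓡 12) 1 M := IsManifold.of_le (n := ∞) (by norm_cast)
  have hσd := hσ.mdifferentiableAt (by simp)
  have h1 := S.form_gen_tderiv hσd (1, 0, 1) v
  have hJ : (fun w => pair (S.J (σ w)) (1, 0, 1)) = S.redJ σ :=
    funext fun w => (S.diagMomentum_eq (σ w)).symm
  rw [hJ] at h1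
  have hf : HasFDerivAt (diagChart x σ) (fderiv ℝ (diagChart x σ) (0, w)) (0, w) :=
    ((S.diagChart_contDiffAt hσ hw).differentiableAt (by simp)).hasFDerivAt
  have h2 : fderiv ℝ (diagChart x σ) (0, w) (0, v) =
      (mfderiv (𝓡 12) 𝓘(ℝ, E12) (extChartAt (𝓡 12) x) (σ w) : E12 →L[ℝ] E12)
        (tderiv σ w v) := by
    have h3 := (HasFDerivAt.comp (g := diagChart x σ) (f := fun w => ((0 : ℝ), w)) w hf
      (hasFDerivAt_prodMk_right (0 : ℝ) w)).fderiv
    have h4 : diagChart x σ ∘ (fun w => ((0 : ℝ), w)) = extChartAt (𝓡 12) x ∘ σ := by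
      funext w
      simp only [diagChart, Function.comp, zero_smul, ofReal_zero, one_smul]
    rw [h4] at h3
    refine Eq.trans ?_ (fderiv_extChartAt_comp hw hσd v)
    rw [h3]
    rfl
  have h5 : fderiv ℝ (diagChart x σ) (0, w) (1, 0) =
      (mfderiv (𝓡 12) 𝓘(ℝ, E12) (extChartAt (𝓡 12) x) (σ w) : E12 →L[ℝ] E12)
        (gen (1, 0, 1) (σ w)) := by
    let c : ℝ → M := fun t => ofReal (t • ((1 : ℝ), (0 : R3), (1 : ℝ))) • σ w
    have hc0 : c 0 = σ w := by simp only [c, zero_smul, ofReal_zero, one_smul]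
    have hcd : MDifferentiableAt 𝓘(ℝ, ℝ) (𝓡 12) c 0 :=
      (S.contMDiffAt_ofReal_smul (contDiffAt_id.smul contDiffAt_const)
        contMDiffAt_const).mdifferentiableAt (by simp)
    have h3 := (HasFDerivAt.comp (g := diagChart x σ) (f := fun t => (t, w)) (0 : ℝ) hf
      (hasFDerivAt_prodMk_left (0 : ℝ) w)).fderiv
    have h4 : diagChart x σ ∘ (fun t => (t, w)) = extChartAt (𝓡 12) x ∘ c := rfl
    rw [h4] at h3
    have h6 := fderiv_extChartAt_comp (x := x) (by rw [hc0]; exact hw) hcd 1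
    have hcongr : ∀ z, z = σ w → ∀ a : E12,
        (mfderiv (𝓡 12) 𝓘(ℝ, E12) (extChartAt (𝓡 12) x) z : E12 →L[ℝ] E12) a =
          (mfderiv (𝓡 12) 𝓘(ℝ, E12) (extChartAt (𝓡 12) x) (σ w) : E12 →L[ℝ] E12) a := by
      rintro z rfl a
      rfl
    rw [S.gen_eq_tderiv]
    refine Eq.trans ?_ (h6.trans (hcongr _ hc0 _))
    rw [h3]
    rfl
  rw [← h1, S.form_eq_inChart hw, h2, h5]

theorem IsReducedCoords.diagChart_contDiffAt (h : S.IsReducedCoords x σ) :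
    ContDiffAt ℝ ∞ (diagChart x σ) 0 :=
  S.diagChart_contDiffAt h.contMDiffAt h.zero_mem_source

theorem IsReducedCoords.hasFDerivAt_fderiv_diagChart (h : S.IsReducedCoords x σ) :
    HasFDerivAt (fderiv ℝ (diagChart x σ)) (fderiv ℝ (fderiv ℝ (diagChart x σ)) 0) 0 :=
  ((h.diagChart_contDiffAt.fderiv_right (m := 1) (by norm_cast)).differentiableAt
    (by simp)).hasFDerivAt

/-- For every angle, the derivative along the slice of the translated slice. -/
theorem IsReducedCoords.tderiv_diag_smul (hx : S.IsAxisymmetricRE x) (h : S.IsReducedCoords x σ) :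
    ∀ᶠ t : ℝ in 𝓝 (0 : ℝ), ∀ u, tderiv (fun w => diag (t : Real.Angle) • σ w) 0 u =
      fderiv ℝ (diagChart x σ) (t, 0) (0, u) := by
  have h1 : ∀ᶠ p in 𝓝 (0 : ℝ × W4), ContDiffAt ℝ 1 (diagChart x σ) p :=
    (h.diagChart_contDiffAt.of_le (by norm_cast)).eventually (by simp)
  have h2 : Filter.Tendsto (fun t : ℝ => (t, (0 : W4))) (𝓝 0) (𝓝 0) := by
    have : Continuous fun t : ℝ => (t, (0 : W4)) := by fun_prop
    exact this.tendsto 0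
  filter_upwards [h2.eventually h1] with t ht u
  have hf := (ht.differentiableAt (by simp)).hasFDerivAt
  have h3 := (HasFDerivAt.comp (g := diagChart x σ) (f := fun w => (t, w)) (0 : W4) hf
      (hasFDerivAt_prodMk_right t (0 : W4))).fderiv
  have h4 : diagChart x σ ∘ (fun w => (t, w)) =
      extChartAt (𝓡 12) x ∘ fun w => diag (t : Real.Angle) • σ w := by
    funext w
    simp only [diagChart, Function.comp, ofReal_smul_diag]
  have hd := h.diag_smul hx (t : Real.Angle)
  rw [h4] at h3
  have hdm : MDifferentiableAt 𝓘(ℝ, W4) (𝓡 12) (fun w => diag (t : Real.Angle) • σ w) 0 :=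
    hd.contMDiffAt.mdifferentiableAt (by simp)
  have h5 := tderiv_eq_fderiv_extChartAt (x := x) (f := fun w => diag (t : Real.Angle) • σ w)
    (v₀ := (0 : W4)) hd.zero hdm
  rw [h5, h3]
  rfl

/-- The Hessian of the momentum of `SO(2)_D` is the quadratic Hamiltonian of the derivative of the
linearized action. -/
theorem IsReducedCoords.hessian_redJ_eq (hx : S.IsAxisymmetricRE x) (h : S.IsReducedCoords x σ)
    (u v : W4) :
    hessian (S.redJ σ) u v =
      S.form x (fderiv ℝ (fderiv ℝ (diagChart x σ)) 0 (1, 0) (0, u)) (tderiv σ 0 v) := by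
  set f := diagChart x σ with hf
  have hsymm : fderiv ℝ (fderiv ℝ f) 0 (1, 0) (0, u) = fderiv ℝ (fderiv ℝ f) 0 (0, u) (1, 0) :=
    (h.diagChart_contDiffAt.isSymmSndFDerivAt (by
      rw [minSmoothness_of_isRCLikeNormedField]; norm_cast)) _ _
  have hσ0 : tderiv σ 0 v = fderiv ℝ f (0, 0) (0, v) := by
    have h1 := (h.tderiv_diag_smul hx).self_of_nhds v
    have h2 : (fun w => diag ((0 : ℝ) : Real.Angle) • σ w) = σ := by
      funext w
      rw [← ofReal_smul_diag, zero_smul, ofReal_zero, one_smul]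
    rwa [h2] at h1
  -- SO(2)_D fixes x, so its generator vanishes at the centre of the slice.
  have hX0 : fderiv ℝ f (0, 0) (1, 0) = 0 := by
    have hfd : HasFDerivAt f (fderiv ℝ f (0, 0)) (0, 0) :=
      (h.diagChart_contDiffAt.differentiableAt (by simp)).hasFDerivAt
    have h3 := HasFDerivAt.comp (g := f) (f := fun t => (t, (0 : W4))) (0 : ℝ) hfd
      (hasFDerivAt_prodMk_left (0 : ℝ) (0 : W4))
    have h4 : f ∘ (fun t => (t, (0 : W4))) = fun _ => extChartAt (𝓡 12) x x := by
      funext t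
      simp only [hf, diagChart, Function.comp, ofReal_smul_diag, h.zero, HamSystem.diag_smul hx]
    rw [h4] at h3
    exact congrArg (fun D : ℝ →L[ℝ] E12 => D 1) (h3.unique (hasFDerivAt_const _ _))
  let Δ : ℝ → ℝ × W4 := fun s => (0, s • u)
  have hΔ : HasDerivAt Δ (0, u) 0 := by
    have := ((hasDerivAt_id (0 : ℝ)).smul_const u)
    rw [one_smul] at this
    exact (hasDerivAt_const (0 : ℝ) (0 : ℝ)).prodMk this
  have hΔ0 : Δ 0 = 0 := by simp [Δ]
  have hfΔ : HasDerivAt (fun s => fderiv ℝ f (Δ s)) (fderiv ℝ (fderiv ℝ f) 0 (0, u)) 0 :=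
    HasFDerivAt.comp_hasDerivAt (l := fderiv ℝ f) (0 : ℝ)
      (by rw [hΔ0]; exact h.hasFDerivAt_fderiv_diagChart) hΔ
  have hX : HasDerivAt (fun s => fderiv ℝ f (Δ s) (1, 0))
      (fderiv ℝ (fderiv ℝ f) 0 (0, u) (1, 0)) 0 := by
    have := hfΔ.clm_apply (hasDerivAt_const (0 : ℝ) ((1 : ℝ), (0 : W4)))
    simpa using this
  have hXs := hX.tendsto_slope_zero
  have hYs : Filter.Tendsto (fun s => fderiv ℝ f (Δ s) (0, v)) (𝓝[≠] 0)
      (𝓝 (fderiv ℝ f (0, 0) (0, v))) := by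
    have h1 : Filter.Tendsto (fun s => fderiv ℝ f (Δ s) (0, v)) (𝓝 0)
        (𝓝 (fderiv ℝ f (Δ 0) (0, v))) :=
      (hfΔ.continuousAt.clm_apply continuousAt_const).tendsto
    rw [hΔ0] at h1
    exact h1.mono_left nhdsWithin_le_nhds
  -- Because the generator vanishes at s = 0, the difference quotient falls on it alone. The
  -- coefficients of Ω and the slice direction need only be continuous.
  let b : ℝ → E12 [⋀^Fin 2]→L[ℝ] ℝ := fun s => S.Ω.inChart x (extChartAt (𝓡 12) x (σ (s • u)))
  have hsu : Filter.Tendsto (fun s : ℝ => s • u) (𝓝 0) (𝓝 0) := by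
    have : Continuous fun s : ℝ => s • u := by fun_prop
    simpa using this.tendsto 0
  have hb : Filter.Tendsto b (𝓝[≠] 0) (𝓝 (S.Ω.inChart x (extChartAt (𝓡 12) x x))) := by
    have h1 : ContinuousAt (S.Ω.inChart x) (extChartAt (𝓡 12) x x) :=
      ((S.symplectic.smooth x).continuousOn).continuousAt (extChartAt_target_mem_nhds x)
    have h2 : Filter.Tendsto σ (𝓝 0) (𝓝 x) := by
      have := h.contMDiffAt.continuousAt.tendsto
      rwa [h.zero] at this
    exact ((h1.tendsto.comp (continuousAt_extChartAt x).tendsto).comp (h2.comp hsu)).mono_left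
      nhdsWithin_le_nhds
  have hlim : Filter.Tendsto (fun s => b s ![s⁻¹ • (fderiv ℝ f (Δ (0 + s)) (1, 0) -
      fderiv ℝ f (Δ 0) (1, 0)), fderiv ℝ f (Δ s) (0, v)]) (𝓝[≠] 0)
      (𝓝 (S.Ω.inChart x (extChartAt (𝓡 12) x x)
        ![fderiv ℝ (fderiv ℝ f) 0 (0, u) (1, 0), fderiv ℝ f (0, 0) (0, v)])) := by
    have h1 : Continuous fun p : (ContinuousMultilinearMap ℝ (fun _ : Fin 2 => E12) ℝ) ×
        (Fin 2 → E12) => p.1 p.2 := continuous_eval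
    have h2 : Continuous fun β : E12 [⋀^Fin 2]→L[ℝ] ℝ => β.toContinuousMultilinearMap :=
      ContinuousAlternatingMap.isEmbedding_toContinuousMultilinearMap.continuous
    have h3 : Filter.Tendsto (fun s => ![s⁻¹ • (fderiv ℝ f (Δ (0 + s)) (1, 0) -
        fderiv ℝ f (Δ 0) (1, 0)), fderiv ℝ f (Δ s) (0, v)]) (𝓝[≠] 0)
        (𝓝 ![fderiv ℝ (fderiv ℝ f) 0 (0, u) (1, 0), fderiv ℝ f (0, 0) (0, v)]) := by
      rw [tendsto_pi_nhds]
      intro i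
      fin_cases i
      · exact hXs
      · exact hYs
    exact (h1.tendsto _).comp (((h2.tendsto _).comp hb).prodMk_nhds h3)
  have hder : HasDerivAt (fun s : ℝ => fderiv ℝ (S.redJ σ) (s • u) v)
      (hessian (S.redJ σ) u v) 0 := by
    have h1 : HasFDerivAt (fderiv ℝ (S.redJ σ)) (fderiv ℝ (fderiv ℝ (S.redJ σ)) 0)
        ((0 : ℝ) • u) := by
      rw [zero_smul]
      exact ((h.redJ_contDiffAt.fderiv_right (m := 1) (by norm_cast)).differentiableAt
        (by simp)).hasFDerivAt
    have h2 := (hasDerivAt_id (0 : ℝ)).smul_const u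
    rw [one_smul] at h2
    have h3 := HasFDerivAt.comp_hasDerivAt (l := fderiv ℝ (S.redJ σ)) (0 : ℝ) h1 h2
    have h4 := h3.clm_apply (hasDerivAt_const (0 : ℝ) v)
    simpa [hessian] using h4
  have hev : ∀ᶠ s in 𝓝 (0 : ℝ), fderiv ℝ (S.redJ σ) (s • u) v =
      b s ![fderiv ℝ f (Δ s) (1, 0), fderiv ℝ f (Δ s) (0, v)] := by
    filter_upwards [hsu.eventually h.eventually_contMDiffAt,
      hsu.eventually h.eventually_mem_source] with s hs hs'
    exact S.fderiv_redJ_eq hs hs' v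
  have hcons (β : E12 [⋀^Fin 2]→L[ℝ] ℝ) (c : ℝ) (a a' : E12) :
      β ![c • a, a'] = c • β ![a, a'] :=
    β.toContinuousMultilinearMap.toMultilinearMap.cons_smul ![a'] c a
  have hslope : (fun s : ℝ => s⁻¹ • (fderiv ℝ (S.redJ σ) ((0 + s) • u) v -
      fderiv ℝ (S.redJ σ) ((0 : ℝ) • u) v)) =ᶠ[𝓝[≠] 0]
      fun s => b s ![s⁻¹ • (fderiv ℝ f (Δ (0 + s)) (1, 0) -
        fderiv ℝ f (Δ 0) (1, 0)), fderiv ℝ f (Δ s) (0, v)] := by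
    have h0 : fderiv ℝ (S.redJ σ) ((0 : ℝ) • u) v = 0 := by
      rw [hev.self_of_nhds, hΔ0]
      change b 0 ![fderiv ℝ f (0, 0) (1, 0), _] = 0
      rw [hX0]
      exact (b 0).map_coord_zero 0 rfl
    filter_upwards [nhdsWithin_le_nhds hev] with s hs
    have h00 : fderiv ℝ f (Δ 0) (1, 0) = 0 := by rw [hΔ0]; exact hX0
    rw [zero_add, hs, h0, h00, sub_zero, sub_zero, hcons]
  have huniq := tendsto_nhds_unique (hder.tendsto_slope_zero.congr' hslope) hlim
  rw [huniq, hsymm, hσ0, S.form_eq_inChart_self]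

end HamSystem

variable [IsManifold (𝓡 12) ∞ M]

open HamSystem

/-- The linearized action is a symplectic circle action, and its infinitesimal generator is the
linear Hamiltonian vector field of the Hessian of the momentum. -/
theorem IsLinearizedAction.exists_isCircleAction {L : Real.Angle → W4 →L[ℝ] W4}
    (hL : IsLinearizedAction x σ L) (hx : S.IsAxisymmetricRE x) (h : S.IsReducedCoords x σ) :
    ∃ B : W4 →L[ℝ] W4, IsCircleAction L B ∧
      ∀ u v, Ω₀ (B u) v = hessian (S.redJ σ) u v := by
  have hB (u : W4) : ∃ w : W4, ∀ v, Ω₀ w v = hessian (S.redJ σ) u v :=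
    Ω₀_surjective (fderiv ℝ (fderiv ℝ (S.redJ σ)) 0 u : W4 →ₗ[ℝ] ℝ)
  choose B hB using hB
  let B' : W4 →ₗ[ℝ] W4 :=
    { toFun := B
      map_add' := fun u u' => Ω₀_ext fun v => by
        rw [Ω₀_add_left, hB, hB, hB, hessian, map_add]
        rfl
      map_smul' := fun c u => Ω₀_ext fun v => by
        rw [RingHom.id_apply, Ω₀_smul_left, hB, hB, hessian, map_smul]
        rfl }
  refine ⟨LinearMap.toContinuousLinearMap B', ⟨?_, ?_, ?_, ?_⟩, hB⟩
  · refine (hL.isTransition 0).eq (S := S) (fun u => ⟨0, ?_⟩) h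
    have : (fun w => diag 0 • σ w) = σ := funext fun w => one_smul _ _
    rw [this]
    simp
  · intro φ ψ u
    -- The group law follows from uniqueness of transitions: composing the step for φ with the
    -- φ-translate of the step for ψ gives the transition for φ + ψ.
    have h1 := (hL.isTransition φ).trans ((hL.isTransition ψ).diag_smul hx h (h.diag_smul hx ψ) φ)
    have h2 : (fun w => diag φ • diag ψ • σ w) = fun w => diag (φ + ψ) • σ w :=
      funext fun w => by rw [diag_add, mul_smul]
    rw [h2] at h1
    exact congrArg (fun D : W4 →L[ℝ] W4 => D u) ((hL.isTransition (φ + ψ)).eq h1 h)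
  · intro φ u v
    exact (hL.isTransition φ).symplectic h (h.diag_smul hx φ) u v
  · intro u
    refine hasDerivAt_of_Ω₀ fun v => ?_
    have h1 : (fun t : ℝ => Ω₀ (L (t : Real.Angle) u) v) =ᶠ[𝓝 0] fun t =>
        S.form x (fderiv ℝ (diagChart x σ) (t, 0) (0, u)) (tderiv σ 0 v) := by
      filter_upwards [h.tderiv_diag_smul hx] with t ht
      rw [(hL.isTransition (t : Real.Angle)).form_eq h, ht]
    have h2 : HasDerivAt (fun t : ℝ => (t, (0 : W4))) (1, 0) 0 :=
      (hasDerivAt_id (0 : ℝ)).prodMk (hasDerivAt_const (0 : ℝ) (0 : W4))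
    have h3 := HasFDerivAt.comp_hasDerivAt (l := fderiv ℝ (diagChart x σ)) (0 : ℝ)
      h.hasFDerivAt_fderiv_diagChart h2
    have h4 := h3.clm_apply (hasDerivAt_const (0 : ℝ) ((0 : ℝ), u))
    let ℓ : E12 →L[ℝ] ℝ := LinearMap.toContinuousLinearMap ((S.form x).flip (tderiv σ 0 v))
    have h5 := ℓ.hasFDerivAt.comp_hasDerivAt (0 : ℝ) h4
    refine (h5.congr_of_eventuallyEq h1).congr_deriv ?_
    change _ = Ω₀ (B u) v
    rw [hB, h.hessian_redJ_eq hx, map_zero, add_zero]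
    rfl

/-- H is invariant, so a slice and its translate have the same reduced Hamiltonian and the same A.
The transition L(φ) therefore commutes with A; differentiating at φ = 0 gives the claim. -/
theorem IsLinearizedAction.linearization_comm {L : Real.Angle → W4 →L[ℝ] W4}
    (hL : IsLinearizedAction x σ L) (hx : S.IsAxisymmetricRE x) (h : S.IsReducedCoords x σ)
    {B : W4 →L[ℝ] W4} (hB : IsCircleAction L B) (u : W4) :
    S.linearization σ (B u) = B (S.linearization σ u) := by
  have h1 (φ : Real.Angle) (u : W4) :
      L φ (S.linearization σ u) = S.linearization σ (L φ u) := by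
    have h2 := (hL.isTransition φ).linearization_comm hx h (h.diag_smul hx φ) u
    have h3 : S.linearization (fun w => diag φ • σ w) = S.linearization σ := by
      have : S.redH (fun w => diag φ • σ w) = S.redH σ :=
        funext fun w => S.H_invariant _ _
      rw [linearization, linearization, this]
    rwa [h3] at h2
  have h2 := (S.linearization σ).hasFDerivAt.comp_hasDerivAt (0 : ℝ) (hB.hasDerivAt u)
  have h3 := hB.hasDerivAt (S.linearization σ u)
  simp only [h1] at h3
  exact h2.unique h3

end InfinitesimalGenerator

/-! ### Independence of coordinates and the stability criterion -/

section MainTheorem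

variable {M : Type*} [TopologicalSpace M] [ChartedSpace E12 M] [MulAction EGroup M]
  [IsManifold (𝓡 12) ∞ M] {S : HamSystem M} {x : M} {σ σ₁ σ₂ : W4 → M}

theorem injective_of_symplectic {T : W4 →L[ℝ] W4} (hT : ∀ u v, Ω₀ (T u) (T v) = Ω₀ u v) :
    Function.Injective T := fun u v huv => Ω₀_ext fun w => by
  rw [← hT u, huv, hT]

theorem IsDefinite.of_injective {B B' : W4 → W4 → ℝ} {T : W4 →L[ℝ] W4} (hB : IsDefinite B)
    (hT : Function.Injective T) (h : ∀ u v, B' u v = B (T u) (T v)) : IsDefinite B' := by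
  have hne (u : W4) (hu : u ≠ 0) : T u ≠ 0 := (map_ne_zero_iff T hT).2 hu
  exact hB.imp (fun hB u hu => by rw [h]; exact hB _ (hne u hu))
    (fun hB u hu => by rw [h]; exact hB _ (hne u hu))

theorem IsEllipticMap.of_comm {A A' T : W4 →L[ℝ] W4} (hA : IsEllipticMap A)
    (hT : Function.Injective T) (h : ∀ u, T (A' u) = A (T u)) : IsEllipticMap A' := by
  let e : W4 ≃ₗ[ℝ] W4 := LinearEquiv.ofInjectiveEndo (T : W4 →ₗ[ℝ] W4) hT
  have he (u : W4) : e u = T u := rfl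
  have h1 : e.conj (A' : W4 →ₗ[ℝ] W4) = (A : W4 →ₗ[ℝ] W4) := by
    ext1 u
    rw [LinearEquiv.conj_apply_apply, he]
    refine (h _).trans ?_
    rw [← he, e.apply_symm_apply]
    rfl
  rwa [IsEllipticMap, ← h1, LinearEquiv.charpoly_conj] at hA

namespace HamSystem

/-- Ellipticity may be witnessed by a different slice from the one in use; the transition conjugates
the two linearizations. -/
theorem IsElliptic.isEllipticMap (hell : S.IsElliptic x) (hx : S.IsAxisymmetricRE x)
    (h : S.IsReducedCoords x σ) : IsEllipticMap (S.linearization σ) := by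
  obtain ⟨σ', h', hA⟩ := hell
  obtain ⟨T, hT⟩ := exists_isTransition hx h' h
  exact hA.of_comm (injective_of_symplectic (hT.symplectic h' h))
    (hT.linearization_comm hx h' h)

theorem isFormallyStable_iff (hx : S.IsAxisymmetricRE x) (h : S.IsReducedCoords x σ) :
    S.IsFormallyStable x ↔
      ∃ c : ℝ, IsDefinite (hessian (fun w => S.redH σ w + c * S.redJ σ w)) := by
  refine ⟨fun ⟨σ', h', c, hc⟩ => ⟨c, ?_⟩, fun hc => ⟨σ, h, hc⟩⟩
  obtain ⟨T, hT⟩ := exists_isTransition hx h' h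
  refine hc.of_injective (injective_of_symplectic (hT.symplectic h' h)) fun u v => ?_
  rw [h.hessian_redH_add_redJ, h'.hessian_redH_add_redJ, hT.hessian_redH hx h' h,
    hT.hessian_redJ hx h' h]

theorem exists_hasNormalFrequencies (hx : S.IsAxisymmetricRE x) (hss : S.IsSemisimple x)
    (hell : S.IsElliptic x) :
    ∃ (om : Fin 2 → ℝ) (n : Fin 2 → ℤ), S.HasNormalFrequencies x om n := by
  obtain ⟨σ, h, hA⟩ := hss
  obtain ⟨L, hL⟩ := exists_isLinearizedAction hx h
  obtain ⟨B, hB, -⟩ := hL.exists_isCircleAction hx h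
  obtain ⟨om, n, P, hP⟩ := exists_normal_form hB (hell.isEllipticMap hx h) hA
    (hL.linearization_comm hx h hB) h.linearization_skew
  exact ⟨om, n, σ, h, L, hL, P, hP⟩

/-- Formal stability in terms of the normal frequencies and the types. -/
theorem HasNormalFrequencies.isFormallyStable_iff {om : Fin 2 → ℝ} {n : Fin 2 → ℤ}
    (hn : S.HasNormalFrequencies x om n) (hx : S.IsAxisymmetricRE x) (hom : ∀ j, om j ≠ 0) :
    S.IsFormallyStable x ↔ ∃ c : ℝ, 0 < (om 0 + c * n 0) * (om 1 + c * n 1) := by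
  obtain ⟨σ, h, L, hL, P, hcompl, horth, hP⟩ := hn
  obtain ⟨B, hB, hBJ⟩ := hL.exists_isCircleAction hx h
  rw [HamSystem.isFormallyStable_iff hx h]
  refine exists_congr fun c => ?_
  rw [← quadratic_form_definite_iff hB (hL.linearization_comm hx h hB) h.linearization_skew hom
    hcompl horth hP c]
  have : hessian (fun w => S.redH σ w + c * S.redJ σ w) =
      fun u v => Ω₀ (S.linearization σ u) v + c * Ω₀ (B u) v := by
    funext u v
    rw [h.hessian_redH_add_redJ, h.form_linearization, hBJ]
  rw [this]

end HamSystem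

end MainTheorem

end AxiRE

end

theorem mainTheorem7 {M : Type*} [TopologicalSpace M] [T2Space M] [SecondCountableTopology M]
    [ConnectedSpace M] [ChartedSpace AxiRE.E12 M] [IsManifold (𝓡 12) ∞ M]
    [MulAction AxiRE.EGroup M] [ProperSMul AxiRE.EGroup M] [FaithfulSMul AxiRE.EGroup M]
    (S : AxiRE.HamSystem M) (x : M) (hx : S.IsAxisymmetricRE x)
    (hss : S.IsSemisimple x) (hell : S.IsElliptic x) :
    (∃ (om : Fin 2 → ℝ) (n : Fin 2 → ℤ), S.HasNormalFrequencies x om n) ∧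
    ∀ (om : Fin 2 → ℝ) (n : Fin 2 → ℤ), S.HasNormalFrequencies x om n →
      (om 0 * om 1 < 0 → (S.IsFormallyStable x ↔ om 0 * n 1 - om 1 * n 0 ≠ 0)) ∧
      (0 < om 0 * om 1 → S.IsFormallyStable x) := by
  refine ⟨AxiRE.HamSystem.exists_hasNormalFrequencies hx hss hell,
    fun om n hn => ⟨fun h => ?_, fun h => ?_⟩⟩
  · have h0 : om 0 ≠ 0 := by rintro h0; simp [h0] at h
    have h1 : om 1 ≠ 0 := by rintro h1; simp [h1] at h
    rw [hn.isFormallyStable_iff hx (Fin.forall_fin_two.2 ⟨h0, h1⟩), AxiRE.exists_mul_pos_iff h]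
  · have h0 : om 0 ≠ 0 := by rintro h0; simp [h0] at h
    have h1 : om 1 ≠ 0 := by rintro h1; simp [h1] at h
    rw [hn.isFormallyStable_iff hx (Fin.forall_fin_two.2 ⟨h0, h1⟩)]
    -- With equal signs the Hessian of H is already definite, so no multiple of the momentum is
    -- needed.
    exact ⟨0, by simpa using h⟩
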